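/- All graphs are finite, simple and undirected, and automorphisms act on the right. Let $m\ge 1$ and $n\ge 2$ be integers. A graph $X$ is a weak $(m,n)$-metacirculant relative to an ordered pair $(\rho,\sigma)$ of automorphisms of $X$ if $\rho$ has exactly $m$ orbits on $V(X)$, each of length $n$, if $\sigma^{-1}\rho\sigma=\rho^{r}$ for some $r\in\mathbb Z_n^*$, and if $\sigma$ permutes the orbits of $\rho$ cyclically. A quartic (4-regular) weak $(m,n)$-metacirculant is of Class II relative to $(\rho,\sigma)$ if every vertex has exactly two neighbours in its own $\rho$-orbit and its other two neighbours lie one in each of two distinct other $\rho$-orbits. A graph is half-arc-transitive if its automorphism group is transitive on vertices and on edges but not on arcs. For $m,n\ge 3$, $r\in\mathbb Z_n^*$ with $r^m=1$, and $t\in\mathbb Z_n$ with $t(r-1)=0$, let $\mathcal Y(m,n;r,t)$ be the graph with vertices $u_i^j$ ($i\in\mathbb Z_m$, $j\in\mathbb Z_n$) and edges $u_i^j\sim u_i^{j+r^i}$ for all $i\in\{0,\dots,m-1\}$, $u_i^j\sim u_{i+1}^{j}$ for $i\in\{0,\dots,m-2\}$, and $u_{m-1}^j\sim u_0^{j+t}$.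 For a quartic half-arc-transitive graph $X$, orient the edges of $X$ by taking one of the two $\mathrm{Aut}\,X$-orbits on arcs. An alternating cycle is an even length cycle of $X$ whose vertices are, alternately, the tail and the head of both of their incident edges on the cycle. All alternating cycles have the same length, half of which is the radius of $X$; any two adjacent (distinct and intersecting) alternating cycles have the same number of common vertices, the attachment number of $X$. The graph $X$ is tightly attached if its attachment number equals its radius. **Theorem.** Let $X$ be a connected quartic half-arc-transitive graph which is a weak $(m,n)$-metacirculant of Class II relative to $(\rho,\sigma)$. Then the following hold. 1. $X$ is a Cayley graph for the group $\langle\rho,\sigma\rangle\le\mathrm{Aut}\,X$. 2. $(\mathrm{Aut}\,X)_v\cong\mathbb Z_2$ for all $v\in V(X)$. 3. $m$ divides $n$, and $d_m=\frac nm>2$. 4. $m,n\ge 3$, and there exist $r\in\mathbb Z_n^*$ and $t\in\mathbb Z_n$ such that $X\cong\mathcal Y(m,n;r,t)$ and such that, in $\mathbb Z_n$, - $r^m=1$, - $m(r-1)=t(r-1)=(r-1)^2=0$, - $\langle m\rangle=\langle t\rangle$, - there exists a unique $c\in\{0,1,\dots,d_m-1\}$ such that $t=cm$ and $m=ct$,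 and - there exists a unique $a\in\{0,1,\dots,d_m-1\}$ such that $at=-am=r-1$. 5. $X$ is tightly attached unless $m$ and $d_m$ are both even and $n=8n_1$ for some integer $n_1>2$ which is even or not squarefree. -/

import Mathlib

namespace Metacirculant

variable {V : Type*}

/-- The orbit of the vertex `v` under the cyclic group generated by the automorphism `ρ`. -/
def orbit {X : SimpleGraph V} (ρ : X ≃g X) (v : V) : Set V :=
  MulAction.orbit (Subgroup.zpowers ρ) v

/-- `ρ` is `(m, n)`-semiregular, where `m ≥ 1` and `n ≥ 2`:
it has `m` orbits of length `n` and no other orbit. -/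
structure IsSemiregular {X : SimpleGraph V} (ρ : X ≃g X) (m n : ℕ) : Prop where
  one_le : 1 ≤ m
  two_le : 2 ≤ n
  card_orbits : (Set.range (orbit ρ)).ncard = m
  card_orbit : ∀ v, (orbit ρ v).ncard = n

/-- `X` is a weak `(m, n)`-metacirculant relative to the ordered pair `(ρ, σ)`: `ρ` is
`(m, n)`-semiregular, and `σ` normalizes `ρ` and permutes the `m` orbits of `ρ` in a single cycle.
Automorphisms are multiplied here as `(σ * ρ) v = σ (ρ v)`; for automorphisms acting on the
right the normalizing relation reads `σ⁻¹ρσ = ρ ^ r`. -/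
structure IsWeakMetacirculant (X : SimpleGraph V) (ρ σ : X ≃g X) (m n : ℕ) : Prop where
  semiregular : IsSemiregular ρ m n
  normalizes : ∃ r : (ZMod n)ˣ, σ * ρ * σ⁻¹ = ρ ^ (r : ZMod n).val
  cyclic : ∀ v w, ∃ k : ℕ, (σ ^ k) v ∈ orbit ρ w

/-- The quartic graph `X` is a weak `(m, n)`-metacirculant of Class II relative to `(ρ, σ)`: the
inner degree is `2`, i.e. each vertex has exactly two neighbours in its own `ρ`-orbit, and each
`ρ`-orbit is joined by a single edge to two other `ρ`-orbits, i.e. the neighbours of a vertex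
outside its `ρ`-orbit are one vertex in each of two distinct further orbits. -/
structure IsClassII (X : SimpleGraph V) (ρ σ : X ≃g X) (m n : ℕ) : Prop where
  weakMetacirculant : IsWeakMetacirculant X ρ σ m n
  inner : ∀ v, {w | X.Adj v w ∧ w ∈ orbit ρ v}.ncard = 2
  outer : ∀ v, ∃ w₁ w₂, {w | X.Adj v w ∧ w ∉ orbit ρ v} = {w₁, w₂} ∧ orbit ρ w₁ ≠ orbit ρ w₂

def IsVertexTransitive (X : SimpleGraph V) : Prop :=
  ∀ u v, ∃ g : X ≃g X, g u = v

def IsEdgeTransitive (X : SimpleGraph V) : Prop :=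
  ∀ u v u' v', X.Adj u v → X.Adj u' v' → ∃ g : X ≃g X, s(g u, g v) = s(u', v')

def IsArcTransitive (X : SimpleGraph V) : Prop :=
  ∀ u v u' v', X.Adj u v → X.Adj u' v' → ∃ g : X ≃g X, g u = u' ∧ g v = v'

/-- Vertex- and edge- but not arc-transitive. -/
structure IsHalfArcTransitive (X : SimpleGraph V) : Prop where
  vertexTransitive : IsVertexTransitive X
  edgeTransitive : IsEdgeTransitive X
  not_arcTransitive : ¬ IsArcTransitive X

/-- `X` is (isomorphic to) a Cayley graph `Cay(G | S)` with `S ⊆ G \ {1}` inverse closed. -/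
def IsCayleyGraphOf (X : SimpleGraph V) (G : Type*) [Group G] : Prop :=
  ∃ S : Set G, 1 ∉ S ∧ (∀ s ∈ S, s⁻¹ ∈ S) ∧ Nonempty (X ≃g SimpleGraph.mulCayley S)

/-- The arc relation of the graph `Y(m, n; r, t)`, where `(i, j)` stands for `u_i^j`:
`u_i^j` is joined to `u_i^{j + r^i}`, and to `u_{i+1}^j` if `i ≠ m - 1` and to `u_0^{j+t}` if
`i = m - 1`. -/
def yArc (m n : ℕ) (r : (ZMod n)ˣ) (t : ZMod n) (x y : ZMod m × ZMod n) : Prop :=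
  (y.1 = x.1 ∧ y.2 = x.2 + (r : ZMod n) ^ x.1.val) ∨
    (y.1 = x.1 + 1 ∧ y.2 = x.2 + if x.1.val + 1 = m then t else 0)

/-- The graph `Y(m, n; r, t)`, meant for `m, n ≥ 3`, `r ^ m = 1` and `t (r - 1) = 0`. -/
def yGraph (m n : ℕ) (r : (ZMod n)ˣ) (t : ZMod n) : SimpleGraph (ZMod m × ZMod n) :=
  SimpleGraph.fromRel (yArc m n r t)

/-- `D` is an oriented graph associated with the action of `Aut X` on `X`:
the `Aut X`-orbit of some arc of `X`. A half-arc-transitive graph has exactly two of them,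
opposite to each other. -/
def IsAutOrientation (X : SimpleGraph V) (D : V → V → Prop) : Prop :=
  ∃ a b, X.Adj a b ∧ ∀ u v, D u v ↔ ∃ g : X ≃g X, g a = u ∧ g b = v

/-- `C` is an alternating cycle with respect to the orientation `D`: an even length cycle every
other vertex of which is the tail, and every other vertex the head, of its two incident edges
on `C`. As a closed walk it is taken to start at one of the tails. -/
def IsAlternatingCycle {X : SimpleGraph V} (D : V → V → Prop) {v : V} (C : X.Walk v v) : Prop :=
  C.IsCycle ∧ Even C.length ∧ ∀ i < C.length,
    (Even i → D (C.getVert i) (C.getVert (i + 1))) ∧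
    (Odd i → D (C.getVert (i + 1)) (C.getVert i))

/-- The radius is `k`: all alternating cycles have length `2k`. -/
def HasRadius (X : SimpleGraph V) (D : V → V → Prop) (k : ℕ) : Prop :=
  (∃ (v : V) (C : X.Walk v v), IsAlternatingCycle D C) ∧
    ∀ (v : V) (C : X.Walk v v), IsAlternatingCycle D C → C.length = 2 * k

/-- Two alternating cycles are adjacent: they are distinct and have a common vertex. -/
def AreAdjacentAlternatingCycles {X : SimpleGraph V} (D : V → V → Prop) {v w : V}
    (C : X.Walk v v) (C' : X.Walk w w) : Prop :=
  IsAlternatingCycle D C ∧ IsAlternatingCycle D C' ∧ C.toSubgraph ≠ C'.toSubgraph ∧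
    ∃ x, x ∈ C.support ∧ x ∈ C'.support

/-- The attachment number is `k`: any two adjacent alternating cycles have exactly `k` common
vertices. -/
def HasAttachmentNumber (X : SimpleGraph V) (D : V → V → Prop) (k : ℕ) : Prop :=
  (∃ (v w : V) (C : X.Walk v v) (C' : X.Walk w w), AreAdjacentAlternatingCycles D C C') ∧
    ∀ (v w : V) (C : X.Walk v v) (C' : X.Walk w w), AreAdjacentAlternatingCycles D C C' →
      {x | x ∈ C.support ∧ x ∈ C'.support}.ncard = k

/-- The attachment number of `X` coincides with its radius. -/
def IsTightlyAttached (X : SimpleGraph V) : Prop :=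
  ∀ D : V → V → Prop, IsAutOrientation X D → ∃ k, HasRadius X D k ∧ HasAttachmentNumber X D k

end Metacirculant

/-!
# Quartic half-arc-transitive weak metacirculants of Class II

Orient the edges of `X` by an orbit of its automorphism group on arcs. An element of `G = ⟨ρ, σ⟩`
that fixes a vertex preserves the orientation and every orbit of `ρ`, so it fixes all neighbours
of the vertex and is trivial (`IsClassII.eq_one_of_fixes`). Hence `G` is regular, and the oriented
graph is the Cayley digraph of `G` with respect to two elements `a` and `b`, where `a` is a power
of `ρ` and `⟨a⟩` is normal of index at least three (`IsClassII.exists_generators`). Two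
consequences of half-arc-transitivity are all that is needed from here on: some automorphism of
the digraph fixes the identity and maps `a` to `b`, and no permutation of `G` reverses all arcs.

Arc stabilizers are trivial, and some automorphism of the group `G` exchanges `a` and `b`
(`arc_rigid_and_exists_swap`). For the proof, consider the closed walks of eight edges that come
from the relation `a (b a b⁻¹) = (b a b⁻¹) a`. Counting exponents of `b` modulo the index of
`⟨a⟩`, the directed walk `1, a, a ^ 2, a ^ 2 b` does not lie on a closed walk of the same shape,
which bounds arc stabilizers by two. A stabilizer of order two can be computed explicitly; it also
leads to an automorphism exchanging `a` and `b`, and forces the commutator `z = b a b⁻¹ a⁻¹` to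
satisfy `z ^ 2 = 1`. Then `a ^ i b ^ j ↦ a ^ (-i) b ^ (-j)` is a well-defined map that reverses
all arcs (`IsSwapPair.exists_reversing_perm`), a contradiction.

If `a` and `b` can be exchanged, then they have the same order, so that `⟨a⟩ = ⟨ρ⟩`, and `z` is
central. Comparing `b ^ m = a ^ t` and `z = a ^ (r - 1)` with their images under the exchange
gives all relations between `m`, `t` and `r`, and the normal form `a ^ j b ^ i` identifies the
digraph with the arcs of `Y(m, n; r, t)` (`IsSwapPair.exists_yArc_parameters`). The vertex
stabilizer has order two since it is transitive on the two out-neighbours.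

An alternating cycle through `g` runs through `g, g a, g p, g p a, …` with `p = a b⁻¹`. If
`z ∈ ⟨p⟩`, then `P = ⟨p⟩` is normal, every alternating cycle covers two cosets `g P` and `g a P`, and
adjacent ones share one coset, so that `X` is tightly attached
(`isTightlyAttached_of_commutator_mem`). If `z ∉ ⟨p⟩`, then the expression of `p ^ m` in terms of
`a`, `b` and `z` yields the parity conditions on `m` and `n`, and `z ^ 2 ≠ 1` the condition on
squares (`IsSwapPair.even_of_commutator_not_mem`, `even_or_not_squarefree`). The one remaining
value `n = 16` only admits the parameters `(m, r, t) = (4, 5, 12)` and `(4, 13, 12)`, for which an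
explicit permutation of the 64 vertices reverses all arcs (`exists_reversing_perm_yArc`).
-/

namespace Metacirculant

/-! ### Metacyclic generating pairs -/

section Group

variable {G : Type*} [Group G]

theorem mem_zpowers_of_pow_orderOf_eq_one [Finite G] {c x y : G}
    (hx : x ∈ Subgroup.zpowers c) (hy : y ∈ Subgroup.zpowers c) (h : y ^ orderOf x = 1) :
    y ∈ Subgroup.zpowers x := by
  rw [← mem_powers_iff_mem_zpowers] at hx hy
  obtain ⟨i, rfl⟩ := hx
  obtain ⟨j, rfl⟩ := hy
  simp only at h ⊢
  obtain ⟨o, ho⟩ := Nat.gcd_dvd_left (orderOf c) i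
  have hpos := orderOf_pos c
  have hg : 0 < (orderOf c).gcd i := Nat.gcd_pos_of_pos_left _ hpos
  have ho' : orderOf (c ^ i) = o := by
    rw [orderOf_pow]
    exact Nat.div_eq_of_eq_mul_right hg ho
  have ho0 : 0 < o := by rw [← ho']; exact orderOf_pos _
  have hdvd : (orderOf c).gcd i ∣ j := by
    rw [ho', ← pow_mul, ← orderOf_dvd_iff_pow_eq_one] at h
    nth_rw 1 [ho] at h
    exact Nat.dvd_of_mul_dvd_mul_right ho0 h
  obtain ⟨w, hw⟩ := hdvd
  refine ⟨Nat.gcdB (orderOf c) i * w, ?_⟩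
  have h1 : (j : ℤ) = orderOf c * (Nat.gcdA (orderOf c) i * w) +
      i * (Nat.gcdB (orderOf c) i * w) := by
    have := Nat.gcd_eq_gcd_ab (orderOf c) i
    have h2 : (j : ℤ) = ((orderOf c).gcd i : ℤ) * w := by exact_mod_cast hw
    rw [h2, this]; ring
  simp only
  rw [← zpow_natCast c j, h1, zpow_add, zpow_mul c (orderOf c : ℤ), zpow_natCast c (orderOf c),
    pow_orderOf_eq_one, one_zpow, one_mul, zpow_mul c (i : ℤ), zpow_natCast c i]

/-- The pair `(a, b)` generates `G`, and the first generator spans a normal subgroup, so that `G`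
is metacyclic. -/
structure IsMetacyclicPair (a b : G) : Prop where
  closure_eq : Subgroup.closure {a, b} = ⊤
  normal : (Subgroup.zpowers a).Normal

namespace IsMetacyclicPair

variable {a b : G}

theorem induction_right [Finite G] (hab : IsMetacyclicPair a b) {p : G → Prop} (h1 : p 1)
    (ha : ∀ g, p g → p (g * a)) (hb : ∀ g, p g → p (g * b)) (g : G) : p g := by
  have key : ∀ c : G, (∀ g, p g → p (g * c)) → ∀ g, p g → p (g * c⁻¹) := by
    intro c hc g hg
    have hk : ∀ k : ℕ, p (g * c ^ k) := by
      intro k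
      induction k with
      | zero => simpa using hg
      | succ k ih => rw [pow_succ, ← mul_assoc]; exact hc _ ih
    have hinv : c⁻¹ = c ^ (orderOf c - 1) := by
      rw [inv_eq_iff_mul_eq_one, ← pow_succ', Nat.sub_add_cancel (orderOf_pos c),
        pow_orderOf_eq_one]
    rw [hinv]
    exact hk _
  have hg : g ∈ Subgroup.closure {a, b} := by rw [hab.closure_eq]; trivial
  induction hg using Subgroup.closure_induction_right with
  | one => exact h1
  | mul_right x hx y hy ih =>
    rcases hy with rfl | rfl
    · exact ha _ ih
    · exact hb _ ih
  | mul_inv_cancel x hx y hy ih =>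
    rcases hy with rfl | rfl
    · exact key _ ha _ ih
    · exact key _ hb _ ih

/-- The exponent of `b` modulo `⟨a⟩`. -/
theorem exists_exponent (hab : IsMetacyclicPair a b) :
    ∃ χ : G →* Multiplicative (ZMod (Subgroup.zpowers a).index),
      χ a = 1 ∧ χ b = Multiplicative.ofAdd 1 ∧ χ.ker = Subgroup.zpowers a := by
  have := hab.normal
  have hgen : ∀ x : G ⧸ Subgroup.zpowers a, x ∈ Subgroup.zpowers (b : G ⧸ Subgroup.zpowers a) := by
    intro x
    obtain ⟨g, rfl⟩ := QuotientGroup.mk_surjective x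
    have hg : g ∈ Subgroup.closure {a, b} := by rw [hab.closure_eq]; trivial
    induction hg using Subgroup.closure_induction with
    | mem x hx =>
      rcases hx with rfl | rfl
      · rw [(QuotientGroup.eq_one_iff x).2 (Subgroup.mem_zpowers x)]; exact one_mem _
      · exact Subgroup.mem_zpowers _
    | one => exact one_mem _
    | mul x y _ _ hx hy => exact mul_mem hx hy
    | inv x _ hx => exact inv_mem hx
  let e := zmodMulEquivOfGenerator hgen (n := (Subgroup.zpowers a).index) rfl
  refine ⟨e.symm.toMonoidHom.comp (QuotientGroup.mk' _), ?_, ?_, ?_⟩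
  · simp
  · exact zmodMulEquivOfGenerator_symm_apply_generator ..
  · ext g
    simp

theorem zpow_mem_iff (hab : IsMetacyclicPair a b) (k : ℤ) :
    b ^ k ∈ Subgroup.zpowers a ↔ ((Subgroup.zpowers a).index : ℤ) ∣ k := by
  obtain ⟨χ, -, hb, hker⟩ := hab.exists_exponent
  have h : b ^ k ∈ Subgroup.zpowers a ↔ χ (b ^ k) = 1 := by rw [← MonoidHom.mem_ker, hker]
  rw [h, map_zpow, hb, ← ofAdd_zsmul, ← ZMod.intCast_zmod_eq_zero_iff_dvd, zsmul_one]
  exact ofAdd_eq_one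

theorem pow_mem_iff (hab : IsMetacyclicPair a b) (k : ℕ) :
    b ^ k ∈ Subgroup.zpowers a ↔ (Subgroup.zpowers a).index ∣ k := by
  have := hab.zpow_mem_iff k
  rwa [zpow_natCast, Int.natCast_dvd_natCast] at this

theorem exists_eq_zpow_mul_zpow (hab : IsMetacyclicPair a b) (g : G) :
    ∃ i j : ℤ, g = a ^ i * b ^ j := by
  have := hab.normal
  obtain ⟨χ, ha, hb, hker⟩ := hab.exists_exponent
  obtain ⟨j, hj⟩ := ZMod.intCast_surjective (Multiplicative.toAdd (χ g))
  have h : g * (b ^ j)⁻¹ ∈ Subgroup.zpowers a := by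
    rw [← hker, MonoidHom.mem_ker, map_mul, map_inv, map_zpow, hb, mul_inv_eq_one,
      ← ofAdd_zsmul]
    apply Multiplicative.toAdd.injective
    simp [hj]
  obtain ⟨i, hi⟩ := h
  exact ⟨i, j, by simp only at hi; rw [hi]; group⟩

theorem exists_conj_eq (hab : IsMetacyclicPair a b) : ∃ r : ℤ, b * a * b⁻¹ = a ^ r := by
  obtain ⟨r, hr⟩ := hab.normal.conj_mem a (Subgroup.mem_zpowers a) b
  exact ⟨r, hr.symm⟩

theorem commutator_mem_left (hab : IsMetacyclicPair a b) :
    b * a * b⁻¹ * a⁻¹ ∈ Subgroup.zpowers a :=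
  mul_mem (hab.normal.conj_mem a (Subgroup.mem_zpowers a) b)
    (inv_mem (Subgroup.mem_zpowers a))

theorem commute_left (hab : IsMetacyclicPair a b) : Commute (b * a * b⁻¹ * a⁻¹) a := by
  obtain ⟨s, hs⟩ := hab.commutator_mem_left
  rw [← hs]
  exact (Commute.refl a).zpow_left s

end IsMetacyclicPair

end Group

/-! ### Cayley digraphs and exchangeable generators -/

section Swap

variable {G : Type*} [Group G] {a b : G}

/-- The arc relation of the Cayley digraph of a group with respect to `{a, b}`. -/
def cayleyArc (a b g h : G) : Prop := h = g * a ∨ h = g * b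

theorem cayleyArc_reverse_iff [Finite G] {ψ : Equiv.Perm G}
    (h : ∀ g h, cayleyArc a b g h → cayleyArc a b (ψ h) (ψ g)) (g k : G) :
    cayleyArc a b (ψ k) (ψ g) ↔ cayleyArc a b g k := by
  refine ⟨fun hk => ?_, h g k⟩
  let R : Set (G × G) := {x | cayleyArc a b x.1 x.2}
  let f : G × G → G × G := fun x => (ψ x.2, ψ x.1)
  have hmaps : Set.MapsTo f R R := fun x hx => h _ _ hx
  have hinj : Function.Injective f := by
    rintro ⟨x, y⟩ ⟨x', y'⟩ hxy
    simp only [f, Prod.mk.injEq, EmbeddingLike.apply_eq_iff_eq] at hxy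
    rw [hxy.1, hxy.2]
  have hsurj : Set.SurjOn f R R :=
    (((Set.toFinite R).injOn_iff_bijOn_of_mapsTo hmaps).1 hinj.injOn).surjOn
  obtain ⟨⟨g', k'⟩, hR, hf⟩ := hsurj (show (ψ k, ψ g) ∈ R from hk)
  simp only [f, Prod.mk.injEq, EmbeddingLike.apply_eq_iff_eq] at hf
  rw [← hf.1, ← hf.2]
  exact hR

theorem zpow_mul_zpow_of_commutator {z : G} (hz : b * a * b⁻¹ * a⁻¹ = z) (hza : Commute z a)
    (hzb : Commute z b) (i j : ℤ) : b ^ i * a ^ j = z ^ (i * j) * (a ^ j * b ^ i) := by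
  have h1 : b * a * b⁻¹ = z * a := by rw [← hz]; group
  have h2 : b * a ^ j * b⁻¹ = z ^ j * a ^ j := by
    rw [← hza.mul_zpow, ← h1, conj_zpow]
  have h3 : (a ^ j)⁻¹ * b * ((a ^ j)⁻¹)⁻¹ = z ^ j * b := by
    have : b * a ^ j = a ^ j * z ^ j * b := by
      rw [(hza.zpow_zpow j j).symm.eq, ← h2]; group
    rw [mul_assoc, inv_inv, this]; group
  have h4 : (a ^ j)⁻¹ * b ^ i * ((a ^ j)⁻¹)⁻¹ = z ^ (i * j) * b ^ i := by
    rw [← conj_zpow, h3, (hzb.zpow_left j).mul_zpow, ← zpow_mul, mul_comm]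
  have h5 : b ^ i * a ^ j = a ^ j * (z ^ (i * j) * b ^ i) := by
    rw [← h4]; group
  rw [h5, ← mul_assoc, ← mul_assoc, (hza.zpow_zpow (i * j) j).eq]

/-- A metacyclic generating pair whose two members are interchanged by an automorphism. -/
structure IsSwapPair (a b : G) : Prop extends IsMetacyclicPair a b where
  exists_swap : ∃ θ : G ≃* G, θ a = b ∧ θ b = a

namespace IsSwapPair

theorem commute_right (hab : IsSwapPair a b) : Commute (b * a * b⁻¹ * a⁻¹) b := by
  obtain ⟨θ, ha, hb⟩ := hab.exists_swap
  have h := (hab.commute_left).map θ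
  simp only [map_mul, map_inv, ha, hb] at h
  have h' := h.inv_left
  rwa [show (a * b * a⁻¹ * b⁻¹)⁻¹ = b * a * b⁻¹ * a⁻¹ by group] at h'

theorem zpow_mul_zpow (hab : IsSwapPair a b) (i j : ℤ) :
    b ^ i * a ^ j = (b * a * b⁻¹ * a⁻¹) ^ (i * j) * (a ^ j * b ^ i) :=
  zpow_mul_zpow_of_commutator rfl (hab.commute_left) hab.commute_right i j

theorem commute_commutator (hab : IsSwapPair a b) (g : G) : Commute (b * a * b⁻¹ * a⁻¹) g := by
  obtain ⟨i, j, rfl⟩ := hab.exists_eq_zpow_mul_zpow g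
  exact ((hab.commute_left).zpow_right i).mul_right
    (hab.commute_right.zpow_right j)

theorem pow_eq_zpow_iff (hab : IsSwapPair a b) (i j : ℤ) : a ^ i = b ^ j ↔ b ^ i = a ^ j := by
  obtain ⟨θ, ha, hb⟩ := hab.exists_swap
  rw [← θ.injective.eq_iff (a := a ^ i), map_zpow, map_zpow, ha, hb]

theorem commutator_pow_index (hab : IsSwapPair a b) :
    (b * a * b⁻¹ * a⁻¹) ^ (Subgroup.zpowers a).index = 1 := by
  set M := (Subgroup.zpowers a).index
  obtain ⟨t, ht⟩ : b ^ M ∈ Subgroup.zpowers a := (hab.pow_mem_iff M).2 dvd_rfl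
  have h1 : a ^ (M : ℤ) = b ^ t :=
    (hab.pow_eq_zpow_iff _ _).2 (by rw [zpow_natCast]; exact ht.symm)
  have h2 := hab.zpow_mul_zpow 1 M
  rw [h1, zpow_one, ← zpow_one_add, ← zpow_add_one, add_comm, one_mul, zpow_natCast] at h2
  exact (mul_eq_right.1 h2.symm)

/-- The commutator lies in `⟨a⟩ ∩ ⟨b⟩`, which is spanned by `a ^ M` as well as by `b ^ M`, where `M`
is the index of `⟨a⟩`. -/
theorem exists_commutator_eq (hab : IsSwapPair a b) :
    ∃ k : ℤ, b * a * b⁻¹ * a⁻¹ = a ^ ((Subgroup.zpowers a).index * k) ∧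
      (b * a * b⁻¹ * a⁻¹)⁻¹ = b ^ ((Subgroup.zpowers a).index * k) := by
  obtain ⟨θ, ha, hb⟩ := hab.exists_swap
  obtain ⟨s, hs⟩ := hab.commutator_mem_left
  simp only at hs
  have h1 : (b * a * b⁻¹ * a⁻¹)⁻¹ = b ^ s := by
    have := congrArg θ hs
    simp only [map_zpow, map_mul, map_inv, ha, hb] at this
    rw [this]; group
  have h2 : b ^ s ∈ Subgroup.zpowers a := by
    rw [← h1]; exact inv_mem (hab.commutator_mem_left)
  obtain ⟨k, rfl⟩ := (hab.zpow_mem_iff s).1 h2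
  exact ⟨k, hs.symm, h1⟩

/-- If the commutator has order at most two, then `a ^ i * b ^ j ↦ a ^ (-i) * b ^ (-j)` is an
automorphism, and it reverses all arcs. -/
theorem exists_reversing_perm (hab : IsSwapPair a b) (hz2 : (b * a * b⁻¹ * a⁻¹) ^ 2 = 1) :
    ∃ ψ : Equiv.Perm G, ∀ g h, cayleyArc a b g h → cayleyArc a b (ψ h) (ψ g) := by
  choose i j hij using hab.exists_eq_zpow_mul_zpow
  let f : G → G := fun g => a ^ (-i g) * b ^ (-j g)
  have hf : ∀ k l : ℤ, f (a ^ k * b ^ l) = a ^ (-k) * b ^ (-l) := by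
    intro k l
    have h := hij (a ^ k * b ^ l)
    set i' := i (a ^ k * b ^ l)
    set j' := j (a ^ k * b ^ l)
    have h1 : a ^ (k - i') = b ^ (j' - l) := by
      rw [sub_eq_neg_add, zpow_add, zpow_sub, zpow_neg, inv_mul_eq_iff_eq_mul, ← mul_assoc, ← h]
      group
    change a ^ (-i') * b ^ (-j') = _
    rw [show -i' = -k + (k - i') by ring, zpow_add, h1, mul_assoc, ← zpow_add]
    congr 2; ring
  have hinv : Function.Involutive f := by
    intro g
    change f (a ^ (-i g) * b ^ (-j g)) = g
    rw [hf, neg_neg, neg_neg, ← hij]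
  refine ⟨hinv.toPerm, ?_⟩
  obtain ⟨s, hs⟩ := hab.commutator_mem_left
  simp only at hs
  have hmul : ∀ l : ℤ, b ^ l * a = a ^ (s * l + 1) * b ^ l := by
    intro l
    have := hab.zpow_mul_zpow l 1
    rw [zpow_one, ← hs, mul_one, ← zpow_mul, ← mul_assoc] at this
    rw [this, zpow_add_one]
  have hs2 : ∀ l : ℤ, a ^ (2 * s * l) = 1 := by
    intro l
    rw [zpow_mul, mul_comm, zpow_mul, hs, show (2 : ℤ) = (2 : ℕ) by rfl, zpow_natCast, hz2,
      one_zpow]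
  rintro g _ (rfl | rfl) <;> obtain ⟨k, l, rfl⟩ := hab.exists_eq_zpow_mul_zpow g
  · left
    change f _ = f _ * a
    rw [show a ^ k * b ^ l * a = a ^ (k + (s * l + 1)) * b ^ l by
      rw [mul_assoc, hmul, ← mul_assoc, ← zpow_add], hf, hf, mul_assoc, hmul, ← mul_assoc,
      ← zpow_add,
      show -(k + (s * l + 1)) + (s * -l + 1) = -k - 2 * s * l by ring, zpow_sub, hs2]
    simp
  · right
    change f _ = f _ * b
    rw [show a ^ k * b ^ l * b = a ^ k * b ^ (l + 1) by rw [mul_assoc, ← zpow_add_one], hf, hf,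
      mul_assoc, ← zpow_add_one]
    congr 2; ring

end IsSwapPair

end Swap

/-! ### Closed walks of eight edges -/

section ArcPerm

variable {G : Type*} [Group G] {a b : G}

/-- The automorphism group of the Cayley digraph of `G` with respect to `{a, b}`. -/
def arcPerms (a b : G) : Subgroup (Equiv.Perm G) where
  carrier := {x | ∀ g h, cayleyArc a b (x g) (x h) ↔ cayleyArc a b g h}
  mul_mem' := fun {x y} hx hy g h => (hx (y g) (y h)).trans (hy g h)
  one_mem' := fun _ _ => Iff.rfl
  inv_mem' := fun {x} hx g h => by
    have := hx (x⁻¹ g) (x⁻¹ h)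
    simpa using this.symm

theorem mulLeft_mem_arcPerms (c : G) : Equiv.mulLeft c ∈ arcPerms a b := by
  intro g h
  simp [cayleyArc, mul_assoc]

/-- Left translation by `c` followed by `x` and by left translation by `d`. -/
theorem translate_mem_arcPerms {x : Equiv.Perm G} (hx : x ∈ arcPerms a b) (c d : G) :
    ∃ y ∈ arcPerms a b, ∀ g, y g = d * x (c * g) :=
  ⟨Equiv.mulLeft d * x * Equiv.mulLeft c,
    mul_mem (mul_mem (mulLeft_mem_arcPerms d) hx) (mulLeft_mem_arcPerms c), fun g => by simp⟩

theorem arcPerms_cases (hne : a ≠ b) {x : Equiv.Perm G} (hx : x ∈ arcPerms a b) (g : G) :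
    (x (g * a) = x g * a ∧ x (g * b) = x g * b) ∨
      (x (g * a) = x g * b ∧ x (g * b) = x g * a) := by
  have h1 : cayleyArc a b (x g) (x (g * a)) := (hx _ _).2 (Or.inl rfl)
  have h2 : cayleyArc a b (x g) (x (g * b)) := (hx _ _).2 (Or.inr rfl)
  have h3 : x (g * a) ≠ x (g * b) := fun h => hne (mul_left_cancel (x.injective h))
  rcases h1 with h1 | h1 <;> rcases h2 with h2 | h2
  · exact absurd (h1.trans h2.symm) h3
  · exact Or.inl ⟨h1, h2⟩
  · exact Or.inr ⟨h1, h2⟩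
  · exact absurd (h1.trans h2.symm) h3

/-- The directed walk `u₀ → u₁ → u₂ → u₃` is a part of a closed walk of eight edges, which returns
from `u₃` to `u₀` by `u₃ ← u₄ ← u₅ → u₆ ← u₇` and a last edge against the arc `u₀ → u₇`. The
closed walk does not backtrack at `u₃`, `u₅`, `u₆` and `u₀`, where its direction changes. -/
def IsEightWalk (a b u₀ u₁ u₂ u₃ : G) : Prop :=
  cayleyArc a b u₀ u₁ ∧ cayleyArc a b u₁ u₂ ∧ cayleyArc a b u₂ u₃ ∧
  ∃ u₄ u₅ u₆ u₇, cayleyArc a b u₄ u₃ ∧ cayleyArc a b u₅ u₄ ∧ cayleyArc a b u₅ u₆ ∧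
    cayleyArc a b u₇ u₆ ∧ cayleyArc a b u₀ u₇ ∧ u₂ ≠ u₄ ∧ u₄ ≠ u₆ ∧ u₅ ≠ u₇ ∧ u₇ ≠ u₁

theorem IsEightWalk.map {x : Equiv.Perm G} (hx : x ∈ arcPerms a b) {u₀ u₁ u₂ u₃ : G}
    (h : IsEightWalk a b u₀ u₁ u₂ u₃) : IsEightWalk a b (x u₀) (x u₁) (x u₂) (x u₃) := by
  obtain ⟨h1, h2, h3, u₄, u₅, u₆, u₇, h4, h5, h6, h7, h8, h9, h10, h11, h12⟩ := h
  exact ⟨(hx _ _).2 h1, (hx _ _).2 h2, (hx _ _).2 h3, x u₄, x u₅, x u₆, x u₇, (hx _ _).2 h4,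
    (hx _ _).2 h5, (hx _ _).2 h6, (hx _ _).2 h7, (hx _ _).2 h8, x.injective.ne h9,
    x.injective.ne h10, x.injective.ne h11, x.injective.ne h12⟩

/-- The relation in the generators that is read off along a closed walk of eight arcs. -/
theorem IsEightWalk.relation {c d e : G} (h : IsEightWalk a b 1 c (c * d) (c * d * e)) :
    ∃ c' v u y : G, (c' = a ∨ c' = b) ∧ (v = a ∧ u = b ∨ v = b ∧ u = a) ∧ (y = a ∨ y = b) ∧
      c' ≠ c ∧ y ≠ e ∧ c * d * e = c' * v * u⁻¹ * v * y := by
  obtain ⟨-, -, -, u₄, u₅, u₆, u₇, h4, h5, h6, h7, h8, h9, h10, h11, h12⟩ := h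
  rw [cayleyArc, one_mul, one_mul] at h8
  obtain ⟨v, hv, h7⟩ : ∃ v, (v = a ∨ v = b) ∧ u₆ = u₇ * v := by
    rcases h7 with h7 | h7 <;> exact ⟨_, by simp, h7⟩
  obtain ⟨w, hw, h6⟩ : ∃ v, (v = a ∨ v = b) ∧ u₆ = u₅ * v := by
    rcases h6 with h6 | h6 <;> exact ⟨_, by simp, h6⟩
  obtain ⟨u, hu, h5⟩ : ∃ v, (v = a ∨ v = b) ∧ u₄ = u₅ * v := by
    rcases h5 with h5 | h5 <;> exact ⟨_, by simp, h5⟩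
  obtain ⟨y, hy, h4⟩ : ∃ v, (v = a ∨ v = b) ∧ c * d * e = u₄ * v := by
    rcases h4 with h4 | h4 <;> exact ⟨_, by simp, h4⟩
  have hvw : v ≠ w := by
    rintro rfl
    exact h11 (mul_right_cancel (h6.symm.trans h7))
  have huw : u ≠ w := by
    rintro rfl
    exact h10 (h5.trans h6.symm)
  have huv : u = v := by
    rcases hv with rfl | rfl <;> rcases hw with rfl | rfl <;> rcases hu with rfl | rfl <;>
      first | rfl | exact absurd rfl hvw | exact absurd rfl huw
  have h5' : u₅ = u₇ * v * w⁻¹ := by rw [← h7, h6]; group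
  refine ⟨u₇, v, w, y, h8, ?_, hy, h12, ?_, ?_⟩
  · rcases hv with rfl | rfl <;> rcases hw with rfl | rfl <;> simp_all
  · rintro rfl
    exact h9 (mul_right_cancel h4)
  · rw [h4, h5, h5', huv]

/-- The walk `1, a, a b, a b a` extends to a closed walk because `a` commutes with `b a b⁻¹`. -/
theorem isEightWalk_generic (hab : IsMetacyclicPair a b) (hne : a ≠ b)
    (hb : b ∉ Subgroup.zpowers a) : IsEightWalk a b 1 a (a * b) (a * b * a) := by
  obtain ⟨r, hr⟩ := hab.exists_conj_eq
  have hcomm : a * (b * a * b⁻¹) = b * a * b⁻¹ * a := by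
    rw [hr]; exact ((Commute.refl a).zpow_right r).eq
  refine ⟨by simp [cayleyArc], Or.inr rfl, Or.inl rfl, b * a * b⁻¹ * a, b * a * b⁻¹, b * a, b,
    Or.inr ?_, Or.inl rfl, Or.inr (by group), Or.inl rfl, by simp [cayleyArc], ?_, ?_, ?_, hne.symm⟩
  · rw [← hcomm]; group
  · intro h
    apply hb
    have h' : b = a⁻¹ * (b * a * b⁻¹ * a) := by rw [← h]; group
    rw [h', hr]
    exact mul_mem (inv_mem (Subgroup.mem_zpowers a))
      (mul_mem (zpow_mem (Subgroup.mem_zpowers a) _) (Subgroup.mem_zpowers a))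
  · intro h
    apply hne
    have : b * a * b⁻¹ * a = b * a * b⁻¹ * b := by rw [h]; group
    exact mul_left_cancel this
  · intro h
    apply hne
    have : b * (a * b⁻¹) = b * 1 := by rw [← mul_assoc, h, mul_one]
    exact mul_inv_eq_one.1 (mul_left_cancel this)

/-- In a relation read off along a closed walk of eight arcs the exponent of `b` vanishes modulo the
index of `⟨a⟩`, which is at least three; this excludes most directed walks of length three. -/
theorem eightWalk_restrictions (hab : IsMetacyclicPair a b)
    (hM : 3 ≤ (Subgroup.zpowers a).index) :
    ¬ IsEightWalk a b 1 a (a * a) (a * a * b) ∧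
    (IsEightWalk a b 1 a (a * a) (a * a * a) → a * a * a = b * b * a⁻¹ * b * b) ∧
    ¬ IsEightWalk a b 1 b (b * b) (b * b * a) ∧
    ¬ IsEightWalk a b 1 b (b * a) (b * a * a) := by
  obtain ⟨M, hM, χ, ha, hb⟩ : ∃ M : ℕ, 3 ≤ M ∧ ∃ χ : G →* Multiplicative (ZMod M),
      χ a = 1 ∧ χ b = Multiplicative.ofAdd 1 := by
    obtain ⟨χ, ha, hb, -⟩ := hab.exists_exponent
    exact ⟨_, hM, χ, ha, hb⟩
  have h1 : (1 : ZMod M) ≠ 0 := by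
    intro h
    rw [← Nat.cast_one, ZMod.natCast_eq_zero_iff] at h
    have := Nat.le_of_dvd one_pos h; omega
  have h2 : (2 : ZMod M) ≠ 0 := by
    intro h
    rw [← Nat.cast_ofNat, ZMod.natCast_eq_zero_iff] at h
    have := Nat.le_of_dvd two_pos h; omega
  have hχ : ∀ {g h : G}, g = h → Multiplicative.toAdd (χ g) = Multiplicative.toAdd (χ h) :=
    fun h => by rw [h]
  refine ⟨fun h => ?_, fun h => ?_, fun h => ?_, fun h => ?_⟩ <;>
    obtain ⟨c', v, u, y, hc, hvu, hy, hc', hy', hrel⟩ := h.relation <;>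
    rcases hc with rfl | rfl <;> rcases hvu with ⟨rfl, rfl⟩ | ⟨rfl, rfl⟩ <;>
    rcases hy with rfl | rfl <;>
    first
    | exact absurd rfl hc'
    | exact absurd rfl hy'
    | exact hrel
    | (have he := hχ hrel
       simp only [map_mul, map_inv, ha, hb, toAdd_mul, toAdd_inv, toAdd_one, toAdd_ofAdd] at he
       first
       | exact absurd (by linear_combination he) h1
       | exact absurd (by linear_combination -he) h1
       | exact absurd (by linear_combination he) h2
       | exact absurd (by linear_combination -he) h2)

end ArcPerm

/-! ### Rigidity on directed walks -/

section Rigidity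

variable {G : Type*} [Group G] [Finite G] {a b : G}

/-- If an automorphism that fixes an arc also fixes the out-neighbours of its head, then by
connectedness it is trivial. -/
theorem eq_one_of_fixes_arc (hab : IsMetacyclicPair a b) (hne : a ≠ b)
    (h : ∀ y ∈ arcPerms a b, ∀ c, (c = a ∨ c = b) → y 1 = 1 → y c = c → y (c * a) = c * a)
    {x : Equiv.Perm G} (hx : x ∈ arcPerms a b) (h1 : x 1 = 1) (ha : x a = a) : x = 1 := by
  have key : ∀ g, x g = g ∧ x (g * a) = g * a ∧ x (g * b) = g * b := by
    have step : ∀ g c, (c = a ∨ c = b) → x g = g → x (g * c) = g * c →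
        x (g * c * a) = g * c * a ∧ x (g * c * b) = g * c * b := by
      intro g c hc hg hgc
      obtain ⟨y, hy, hyx⟩ := translate_mem_arcPerms hx g g⁻¹
      have h2 := h y hy c hc (by simp [hyx, hg]) (by simp [hyx, hgc])
      rw [hyx, inv_mul_eq_iff_eq_mul, ← mul_assoc] at h2
      rcases arcPerms_cases hne hx (g * c) with h3 | h3 <;> rw [hgc] at h3
      · exact h3
      · exact absurd (mul_left_cancel (h2.symm.trans h3.1)) hne
    intro g
    induction g using hab.induction_right with
    | h1 =>
      rcases arcPerms_cases hne hx 1 with h3 | h3 <;> rw [h1] at h3 <;>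
        simp only [one_mul] at h3 ⊢
      · exact ⟨h1, h3⟩
      · exact absurd (ha.symm.trans h3.1) hne
    | ha g ih => exact ⟨ih.2.1, step g a (Or.inl rfl) ih.1 ih.2.1⟩
    | hb g ih => exact ⟨ih.2.2, step g b (Or.inr rfl) ih.1 ih.2.2⟩
  ext g
  exact (key g).1

/-- The analogue of `eq_one_of_fixes_arc` for directed walks of length two. -/
theorem eq_one_of_fixes_two_arc (hab : IsMetacyclicPair a b) (hne : a ≠ b)
    (h : ∀ y ∈ arcPerms a b, ∀ c d, (c = a ∨ c = b) → (d = a ∨ d = b) → y 1 = 1 → y c = c →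
      y (c * d) = c * d → y (c * d * a) = c * d * a)
    {x : Equiv.Perm G} (hx : x ∈ arcPerms a b) {c d : G} (hc : c = a ∨ c = b)
    (hd : d = a ∨ d = b) (h1 : x 1 = 1) (h2 : x c = c) (h3 : x (c * d) = c * d) : x = 1 := by
  have step : ∀ g e f, (e = a ∨ e = b) → (f = a ∨ f = b) → x g = g → x (g * e) = g * e →
      x (g * e * f) = g * e * f →
      x (g * e * f * a) = g * e * f * a ∧ x (g * e * f * b) = g * e * f * b := by
    intro g e f he hf hg hge hgef
    obtain ⟨y, hy, hyx⟩ := translate_mem_arcPerms hx g g⁻¹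
    have h4 := h y hy e f he hf (by simp [hyx, hg]) (by simp [hyx, hge])
      (by rw [hyx, ← mul_assoc, hgef]; group)
    rw [hyx, inv_mul_eq_iff_eq_mul, ← mul_assoc, ← mul_assoc] at h4
    rcases arcPerms_cases hne hx (g * e * f) with h5 | h5 <;> rw [hgef] at h5
    · exact h5
    · exact absurd (mul_left_cancel (h4.symm.trans h5.1)) hne
  have key : ∀ g, ∃ k e, (e = a ∨ e = b) ∧ c * g = k * e ∧ x k = k ∧ x (k * e) = k * e ∧
      x (k * e * a) = k * e * a ∧ x (k * e * b) = k * e * b := by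
    intro g
    induction g using hab.induction_right with
    | h1 =>
      refine ⟨1, c, hc, by simp, h1, by simpa using h2, ?_⟩
      rcases arcPerms_cases hne hx c with h4 | h4 <;> rw [h2] at h4 <;> simp only [one_mul]
      · exact h4
      · rcases hd with rfl | rfl
        · exact absurd (mul_left_cancel (h3.symm.trans h4.1)) hne
        · exact absurd (mul_left_cancel (h3.symm.trans h4.2)) hne.symm
    | ha g ih =>
      obtain ⟨k, e, he, hk, h4, h5, h6, h7⟩ := ih
      exact ⟨k * e, a, Or.inl rfl, by rw [← hk, mul_assoc], h5, h6,
        step k e a he (Or.inl rfl) h4 h5 h6⟩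
    | hb g ih =>
      obtain ⟨k, e, he, hk, h4, h5, h6, h7⟩ := ih
      exact ⟨k * e, b, Or.inr rfl, by rw [← hk, mul_assoc], h5, h7,
        step k e b he (Or.inr rfl) h4 h5 h7⟩
  ext g
  obtain ⟨k, e, -, hk, -, h5, -⟩ := key (c⁻¹ * g)
  rw [mul_inv_cancel_left] at hk
  rw [hk, h5]; rfl

theorem exists_mulEquiv_of_translate (hab : IsMetacyclicPair a b) (s : Equiv.Perm G)
    (h1 : s 1 = 1) (ha : ∀ g, s (a * g) = b * s g) (hb : ∀ g, s (b * g) = a * s g) :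
    ∃ θ : G ≃* G, θ a = b ∧ θ b = a := by
  have hsa : s a = b := by simpa [h1] using ha 1
  have hsb : s b = a := by simpa [h1] using hb 1
  have hmul : ∀ g h, s (g * h) = s g * s h := by
    intro g
    induction g using hab.induction_right with
    | h1 => simp [h1]
    | ha g ih => intro h; rw [mul_assoc, ih, ha, ih, hsa, mul_assoc]
    | hb g ih => intro h; rw [mul_assoc, ih, hb, ih, hsb, mul_assoc]
  exact ⟨MulEquiv.mk' s hmul, hsa, hsb⟩

/-- If arc stabilizers are trivial, then the automorphism that fixes `1` and maps `a` to `b` is a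
group automorphism. -/
theorem exists_swap_of_rigid (hab : IsMetacyclicPair a b) (hne : a ≠ b)
    (hrigid : ∀ x ∈ arcPerms a b, x 1 = 1 → x a = a → x = 1)
    (hx : ∃ x ∈ arcPerms a b, x 1 = 1 ∧ x a = b) : ∃ θ : G ≃* G, θ a = b ∧ θ b = a := by
  obtain ⟨x, hx, h1, ha⟩ := hx
  have hb : x b = a := by
    rcases arcPerms_cases hne hx 1 with h | h <;> simp only [one_mul, h1] at h
    · exact absurd (h.1.symm.trans ha) hne
    · exact h.2
  have hstep : ∀ c d, (c = a ∧ d = b ∨ c = b ∧ d = a) → ∀ g, x (c * g) = d * x g := by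
    intro c d hcd
    have hc : x c = d := by rcases hcd with ⟨rfl, rfl⟩ | ⟨rfl, rfl⟩ <;> assumption
    obtain ⟨y, hy, hyx⟩ := translate_mem_arcPerms hx c d⁻¹
    have hy1 : y 1 = 1 := by simp [hyx, hc]
    have hya : y a = b := by
      rcases arcPerms_cases hne hy 1 with h | h <;> simp only [one_mul, hy1] at h
      · exfalso
        have h2 := hyx c⁻¹
        rw [hrigid y hy hy1 h.1, mul_inv_cancel, h1, mul_one, Equiv.Perm.coe_one, id,
          inv_inj] at h2
        rcases hcd with ⟨rfl, rfl⟩ | ⟨rfl, rfl⟩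
        · exact hne h2
        · exact hne h2.symm
      · exact h.1
    have hxy : x⁻¹ * y = 1 := by
      apply hrigid _ (mul_mem (inv_mem hx) hy)
      · rw [Equiv.Perm.mul_apply, hy1, Equiv.Perm.inv_eq_iff_eq, h1]
      · rw [Equiv.Perm.mul_apply, hya, Equiv.Perm.inv_eq_iff_eq, ha]
    intro g
    have h2 := hyx g
    rw [← inv_mul_eq_one.1 hxy] at h2
    rw [h2]; group
  exact exists_mulEquiv_of_translate hab x h1 (hstep a b (by simp)) (hstep b a (by simp))

/-- If arc stabilizers are not trivial, then two-arc stabilizers are: otherwise the automorphism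
group would be transitive on directed walks of length three, but `1, a, a b, a b a` is an
eight-walk and `1, a, a ^ 2, a ^ 2 b` is not. -/
theorem eq_one_of_fixes_two_arc_of_transitive (hab : IsMetacyclicPair a b) (hne : a ≠ b)
    (hM : 3 ≤ (Subgroup.zpowers a).index) (hx : ∃ x ∈ arcPerms a b, x 1 = 1 ∧ x a = b)
    {y : Equiv.Perm G} (hy : y ∈ arcPerms a b) (hy1 : y 1 = 1) (hya : y a = a)
    (hyab : y (a * b) = a * a) :
    (∀ c d, (c = a ∨ c = b) → (d = a ∨ d = b) →
      ∃ w ∈ arcPerms a b, w 1 = 1 ∧ w a = c ∧ w (a * a) = c * d) ∧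
    ∀ x ∈ arcPerms a b, ∀ c d, (c = a ∨ c = b) → (d = a ∨ d = b) → x 1 = 1 → x c = c →
      x (c * d) = c * d → x = 1 := by
  have hbnot : b ∉ Subgroup.zpowers a := by
    have := hab.pow_mem_iff 1
    rw [pow_one] at this
    rw [this, Nat.dvd_one]
    omega
  have htrans : ∀ c d, (c = a ∨ c = b) → (d = a ∨ d = b) →
      ∃ w ∈ arcPerms a b, w 1 = 1 ∧ w a = c ∧ w (a * a) = c * d := by
    intro c d hc hd
    obtain ⟨v, hv, hv1, hva⟩ : ∃ v ∈ arcPerms a b, v 1 = 1 ∧ v a = c := by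
      rcases hc with rfl | rfl
      · exact ⟨1, one_mem _, rfl, rfl⟩
      · exact hx
    have hv2 : v (a * a) = c * d ∨ v (a * b) = c * d := by
      rcases arcPerms_cases hne hv a with h | h <;> rw [hva] at h <;>
        rcases hd with rfl | rfl <;> simp [h.1, h.2]
    rcases hv2 with hv2 | hv2
    · exact ⟨v, hv, hv1, hva, hv2⟩
    · refine ⟨v * y⁻¹, mul_mem hv (inv_mem hy), ?_, ?_, ?_⟩
      · rw [Equiv.Perm.mul_apply, Equiv.Perm.inv_eq_iff_eq.2 hy1.symm, hv1]
      · rw [Equiv.Perm.mul_apply, Equiv.Perm.inv_eq_iff_eq.2 hya.symm, hva]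
      · rw [Equiv.Perm.mul_apply, Equiv.Perm.inv_eq_iff_eq.2 hyab.symm, hv2]
  refine ⟨htrans, fun x hx' c d hc hd => eq_one_of_fixes_two_arc hab hne ?_ hx' hc hd⟩
  intro x hx c d hc hd h1 h2 h3
  rcases arcPerms_cases hne hx (c * d) with h | h <;> rw [h3] at h
  · exact h.1
  exfalso
  obtain ⟨w, hw, hw1, hwa, hwaa⟩ := htrans c d hc hd
  have hz : (w⁻¹ * x * w) (a * a * a) = a * a * b := by
    rw [Equiv.Perm.mul_apply, Equiv.Perm.mul_apply, Equiv.Perm.inv_eq_iff_eq]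
    rcases arcPerms_cases hne hw (a * a) with h' | h' <;> rw [hwaa] at h' <;>
      rw [h'.1, h'.2]
    · exact h.1
    · exact h.2
  have hyz : ∃ u ∈ arcPerms a b, u 1 = 1 ∧ u a = a ∧ u (a * b) = a * a ∧
      u (a * b * a) = a * a * b := by
    rcases arcPerms_cases hne hy (a * b) with h' | h' <;> rw [hyab] at h'
    · refine ⟨w⁻¹ * x * w * y, mul_mem (mul_mem (mul_mem (inv_mem hw) hx) hw) hy, ?_, ?_, ?_, ?_⟩
      · simp only [Equiv.Perm.mul_apply, hy1, hw1, h1, Equiv.Perm.inv_eq_iff_eq]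
      · simp only [Equiv.Perm.mul_apply, hya, hwa, h2, Equiv.Perm.inv_eq_iff_eq]
      · simp only [Equiv.Perm.mul_apply, hyab, hwaa, h3, Equiv.Perm.inv_eq_iff_eq]
      · rw [Equiv.Perm.mul_apply, h'.1, hz]
    · exact ⟨y, hy, hy1, hya, hyab, h'.1⟩
  obtain ⟨u, hu, hu1, hua, huab, huaba⟩ := hyz
  have := (isEightWalk_generic hab hne hbnot).map hu
  rw [hu1, hua, huab, huaba] at this
  exact (eightWalk_restrictions hab hM).1 this

end Rigidity

/-! ### Arc stabilizers of order two -/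

section TwoArc

variable {G : Type*} [Group G] [Finite G] {a b : G}

/-- If arc stabilizers have order two, then up to a translation the two nontrivial elements `x`,
`y` act on the words in `a` and `b` by exchanging the letters at the odd, respectively even,
positions. -/
theorem exists_alternating_swaps (hab : IsMetacyclicPair a b) (hne : a ≠ b)
    (hM : 3 ≤ (Subgroup.zpowers a).index) (hx : ∃ x ∈ arcPerms a b, x 1 = 1 ∧ x a = b)
    {y : Equiv.Perm G} (hy : y ∈ arcPerms a b) (hy1 : y 1 = 1) (hya : y a = a)
    (hyab : y (a * b) = a * a) :
    a * a * a = b * b * a⁻¹ * b * b ∧ (∃ θ : G ≃* G, θ a = b ∧ θ b = a) ∧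
    ∃ x y : Equiv.Perm G, x 1 = 1 ∧ (∀ g, x (a * g) = b * y g) ∧ (∀ g, x (b * g) = a * y g) ∧
      (∀ g, y (a * g) = a * x g) ∧ ∀ g, y (b * g) = b * x g := by
  obtain ⟨htrans, hrigid⟩ :=
    eq_one_of_fixes_two_arc_of_transitive hab hne hM hx hy hy1 hya hyab
  obtain ⟨hr1, hr2, hr3, hr4⟩ := eightWalk_restrictions hab hM
  have hbnot : b ∉ Subgroup.zpowers a := by
    have := hab.pow_mem_iff 1
    rw [pow_one] at this
    rw [this, Nat.dvd_one]
    omega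
  have hgen := isEightWalk_generic hab hne hbnot
  have heq : ∀ u ∈ arcPerms a b, ∀ v ∈ arcPerms a b, ∀ c d, (c = a ∨ c = b) → (d = a ∨ d = b) →
      u 1 = v 1 → u c = v c → u (c * d) = v (c * d) → u = v := by
    intro u hu v hv c d hc hd h1 h2 h3
    have : v⁻¹ * u = 1 := by
      apply hrigid _ (mul_mem (inv_mem hv) hu) c d hc hd <;>
        rw [Equiv.Perm.mul_apply, Equiv.Perm.inv_eq_iff_eq] <;> assumption
    exact (inv_mul_eq_one.1 this).symm
  -- The action of `y` on the words of length at most three.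
  have hyb : y b = b := by
    rcases arcPerms_cases hne hy 1 with h | h <;> simp only [one_mul, hy1] at h
    · exact h.2
    · exact absurd (hya.symm.trans h.1) hne
  have hyaa : y (a * a) = a * b := by
    rcases arcPerms_cases hne hy a with h | h <;> rw [hya] at h
    · exact absurd (mul_left_cancel (hyab.symm.trans h.2)) hne
    · exact h.1
  have hyy : ∀ g, y (y g) = g := by
    have : y * y = 1 := hrigid _ (mul_mem hy hy) a a (Or.inl rfl) (Or.inl rfl)
      (by simp [hy1]) (by simp [hya]) (by simp [hyaa, hyab])
    intro g
    rw [← Equiv.Perm.mul_apply, this]; rfl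
  have hyne : y ≠ 1 := by
    rintro rfl
    exact hne (mul_left_cancel hyab).symm
  have hyaba : y (a * b * a) = a * a * a := by
    rcases arcPerms_cases hne hy (a * b) with h | h <;> rw [hyab] at h
    · exact h.1
    · have := hgen.map hy
      rw [hy1, hya, hyab, h.1] at this
      exact absurd this hr1
  have hyabb : y (a * b * b) = a * a * b := by
    rcases arcPerms_cases hne hy (a * b) with h | h <;> rw [hyab] at h
    · exact h.2
    · exact absurd (mul_left_cancel (hyaba.symm.trans h.1)) hne
  have hyaaa : y (a * a * a) = a * b * a := by rw [← hyaba, hyy]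
  have hyaab : y (a * a * b) = a * b * b := by rw [← hyabb, hyy]
  have hrel : a * a * a = b * b * a⁻¹ * b * b := by
    have := hgen.map hy
    rw [hy1, hya, hyab, hyaba] at this
    exact hr2 this
  have hyba : y (b * a) = b * b ∧ y (b * b) = b * a := by
    rcases arcPerms_cases hne hy b with h | h <;> rw [hyb] at h
    · exact absurd (hrigid y hy b a (Or.inr rfl) (Or.inl rfl) hy1 hyb h.1) hyne
    · exact h
  have hybbb : y (b * b * b) = b * a * b := by
    obtain ⟨w, hw, hw1, hwa, hwaa⟩ := htrans b b (Or.inr rfl) (Or.inr rfl)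
    have h1 : IsEightWalk a b 1 b (b * b) ((w * y) (a * b * a)) := by
      have := hgen.map (mul_mem hw hy)
      simp only [Equiv.Perm.mul_apply, hy1, hya, hyab, hw1, hwa, hwaa] at this
      exact this
    have h2 : (w * y) (a * b * a) = b * b * b := by
      rcases h1.2.2.1 with h | h
      · rw [h] at h1
        exact absurd h1 hr3
      · exact h
    rw [h2] at h1
    have h3 := h1.map hy
    rw [hy1, hyb, hyba.2] at h3
    rcases h3.2.2.1 with h | h
    · rw [h] at h3
      exact absurd h3 hr4
    · exact h
  -- The conjugate of `y` by `a` fixes `a⁻¹` and `1` and exchanges `a` and `b`.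
  obtain ⟨x, hx, hxy⟩ := translate_mem_arcPerms hy a a⁻¹
  have hx1 : x 1 = 1 := by simp [hxy, hya]
  have hxa : x a = b := by rw [hxy, hyaa]; group
  have hxb : x b = a := by rw [hxy, hyab]; group
  have hxaa : x (a * a) = b * a := by rw [hxy, ← mul_assoc, hyaaa]; group
  have hxab : x (a * b) = b * b := by rw [hxy, ← mul_assoc, hyaab]; group
  have hxba : x (b * a) = a * a := by rw [hxy, ← mul_assoc, hyaba]; group
  have hxbb : x (b * b) = a * b := by rw [hxy, ← mul_assoc, hyabb]; group
  have hE12 : ∀ c d, (c = a ∧ d = b ∨ c = b ∧ d = a) → ∀ g, x (c * g) = d * y g := by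
    intro c d hcd
    obtain ⟨w, hw, hwx⟩ := translate_mem_arcPerms hx c d⁻¹
    have hw1 : w 1 = 1 := by
      rcases hcd with ⟨rfl, rfl⟩ | ⟨rfl, rfl⟩ <;> simp [hwx, hxa, hxb]
    have hwa : w a = a := by
      rcases hcd with ⟨rfl, rfl⟩ | ⟨rfl, rfl⟩ <;> simp [hwx, hxaa, hxba]
    have hwaa : w (a * a) = y (a * a) := by
      rcases arcPerms_cases hne hw a with h | h <;> rw [hwa] at h
      · exfalso
        have h2 := hwx c⁻¹
        rw [hrigid w hw a a (Or.inl rfl) (Or.inl rfl) hw1 hwa h.1, mul_inv_cancel, hx1, mul_one,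
          Equiv.Perm.coe_one, id, inv_inj] at h2
        rcases hcd with ⟨rfl, rfl⟩ | ⟨rfl, rfl⟩
        · exact hne h2
        · exact hne h2.symm
      · rw [h.1, hyaa]
    have hwy : w = y := heq w hw y hy a a (Or.inl rfl) (Or.inl rfl) (hw1.trans hy1.symm)
      (hwa.trans hya.symm) hwaa
    intro g
    have := hwx g
    rw [hwy] at this
    rw [this]; group
  have hE3 : ∀ g, y (a * g) = a * x g := by
    intro g
    rw [hxy]; group
  have hE4 : ∀ g, y (b * g) = b * x g := by
    obtain ⟨w, hw, hwy⟩ := translate_mem_arcPerms hy b b⁻¹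
    have hwx : w = x := by
      apply heq w hw x hx b b (Or.inr rfl) (Or.inr rfl)
      · simp [hwy, hyb, hx1]
      · rw [hwy, hyba.2, hxb]; group
      · rw [hwy, ← mul_assoc, hybbb, hxbb]; group
    intro g
    have := hwy g
    rw [hwx] at this
    rw [this]; group
  have hcomm : ∀ g, x (y g) = y (x g) := by
    have : x * y = y * x := by
      apply heq _ (mul_mem hx hy) _ (mul_mem hy hx) a a (Or.inl rfl) (Or.inl rfl)
      · simp [hx1, hy1]
      · simp [hxa, hya, hyb]
      · simp [hyaa, hxab, hxaa, hyba.1]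
    intro g
    rw [← Equiv.Perm.mul_apply, this]; rfl
  have hE1 := hE12 a b (by simp)
  have hE2 := hE12 b a (by simp)
  refine ⟨hrel, exists_mulEquiv_of_translate hab (x * y) (by simp [hx1, hy1]) ?_ ?_,
    x, y, hx1, hE1, hE2, hE3, hE4⟩
  · intro g
    rw [Equiv.Perm.mul_apply, hE3, hE1, Equiv.Perm.mul_apply, hcomm]
  · intro g
    rw [Equiv.Perm.mul_apply, hE4, hE2, Equiv.Perm.mul_apply, hcomm]

/-- Here the index of `⟨a⟩` is four, so that the commutator `z` is `a ^ (4 k)` for some `k`.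
Applying `x` to the relation `b a = z a b` yields `a ^ 2 = (b a) ^ (2 k) b ^ 2`, whence
`z ^ 2 = 1`. -/
theorem commutator_sq_of_alternating_swaps (hab : IsSwapPair a b)
    (hM : 3 ≤ (Subgroup.zpowers a).index) (hrel : a * a * a = b * b * a⁻¹ * b * b)
    {x y : Equiv.Perm G} (hx1 : x 1 = 1) (hxa : ∀ g, x (a * g) = b * y g)
    (hxb : ∀ g, x (b * g) = a * y g) (hya : ∀ g, y (a * g) = a * x g)
    (hyb : ∀ g, y (b * g) = b * x g) : (b * a * b⁻¹ * a⁻¹) ^ 2 = 1 := by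
  set z := b * a * b⁻¹ * a⁻¹ with hz
  have hzc := hab.commute_commutator
  have hcomm := hab.zpow_mul_zpow
  rw [← hz] at hzc hcomm
  have hb4 : b ^ (4 : ℤ) = a ^ (4 : ℤ) * z ^ (2 : ℤ) := by
    have h1 := hcomm 2 (-1)
    have h2 : a ^ (3 : ℤ) = b ^ (2 : ℤ) * a ^ (-1 : ℤ) * b ^ (2 : ℤ) := by
      rw [show (3 : ℤ) = (3 : ℕ) by rfl, zpow_natCast, pow_succ, pow_two, hrel, zpow_two,
        zpow_neg_one]
      simp only [mul_assoc]
    rw [h1] at h2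
    have h3 : a ^ (4 : ℤ) = a * a ^ (3 : ℤ) := by group
    have h4 : z ^ (2 * -1 : ℤ) * (a ^ (-1 : ℤ) * b ^ (2 : ℤ)) * b ^ (2 : ℤ) =
        z ^ (-2 : ℤ) * a⁻¹ * b ^ (4 : ℤ) := by group
    rw [h4] at h2
    rw [h3, h2, ← mul_assoc, ← mul_assoc, ← ((hzc a).zpow_left (-2)).eq, mul_inv_cancel_right,
      mul_assoc, ← ((hzc (b ^ (4 : ℤ))).zpow_left 2).eq]
    group
  have hza : z ∈ Subgroup.zpowers a := hab.commutator_mem_left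
  have hM4 : (Subgroup.zpowers a).index = 4 := by
    have h1 : b ^ 4 ∈ Subgroup.zpowers a := by
      have : b ^ 4 = b ^ (4 : ℤ) := by norm_cast
      rw [this, hb4]
      exact mul_mem (zpow_mem (Subgroup.mem_zpowers a) _) (zpow_mem hza _)
    have h2 := (hab.pow_mem_iff 4).1 h1
    have h3 := Nat.le_of_dvd (by norm_num) h2
    interval_cases h : (Subgroup.zpowers a).index
    · omega
    · rfl
  obtain ⟨k, hk⟩ : ∃ k : ℕ, z = a ^ (4 * k) := by
    obtain ⟨k, hk, -⟩ := hab.exists_commutator_eq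
    rw [hM4, ← hz] at hk
    have : z ∈ Submonoid.powers (a ^ 4) := by
      rw [mem_powers_iff_mem_zpowers]
      exact ⟨k, by simp only; rw [hk, zpow_mul]; norm_cast⟩
    obtain ⟨k, hk⟩ := this
    exact ⟨k, by rw [← hk, pow_mul]⟩
  have hz4 : z ^ 4 = 1 := by
    have := hab.commutator_pow_index
    rwa [hM4, ← hz] at this
  have hzk : ∀ j : ℤ, z ^ j = a ^ (4 * k * j : ℤ) := by
    intro j
    rw [hk, ← zpow_natCast, ← zpow_mul]; push_cast; rfl
  -- `x` maps `a ^ (4 * k) * (a * b)` to `(b * a) ^ (2 * k) * (b * b)`, and `b * a` to `a * a`.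
  have hpow : ∀ (j : ℕ) (g : G), x (a ^ (2 * j) * g) = (b * a) ^ j * x g := by
    intro j
    induction j with
    | zero => simp
    | succ j ih =>
      intro g
      have h1 : a ^ (2 * (j + 1)) * g = a ^ (2 * j) * (a * (a * g)) := by
        rw [mul_add, pow_add, mul_one, pow_two a]; simp only [mul_assoc]
      rw [h1, ih, hxa, hya, pow_succ]
      simp only [mul_assoc]
  have hkey : a * a = (b * a) ^ (2 * k) * (b * b) := by
    have h1 : x (b * (a * 1)) = a * (a * x 1) := by rw [hxb, hya]
    have h2 : b * (a * 1) = a ^ (2 * (2 * k)) * (a * (b * 1)) := by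
      rw [show 2 * (2 * k) = 4 * k by ring, ← hk, hz]; group
    rw [h2, hpow, hxa, hyb, hx1] at h1
    simpa using h1.symm
  have hba : (b * a) ^ 2 = z ^ (-1 : ℤ) * (b ^ (2 : ℤ) * a ^ (2 : ℤ)) := by
    have h1 := hcomm 1 1
    have h2 : a * b = z ^ (-1 : ℤ) * (b * a) := by
      simp only [zpow_one, mul_one] at h1
      rw [h1]; group
    have h3 : (b * a) ^ 2 = b * (a * b) * a := by rw [pow_two]; simp only [mul_assoc]
    rw [h3, h2, ← mul_assoc, ← ((hzc b).zpow_left (-1)).eq, zpow_two, zpow_two]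
    simp only [mul_assoc]
  have hcommsq : Commute (b ^ (2 : ℤ)) (a ^ (2 : ℤ)) := by
    have := hcomm 2 2
    rw [show (2 * 2 : ℤ) = (4 : ℕ) by norm_num, zpow_natCast, hz4, one_mul] at this
    exact this
  have hkey2 : a ^ (2 : ℤ) = a ^ (-(4 * k * k) + 2 * k : ℤ) * b ^ (2 * k + 2 : ℤ) := by
    have h1 : (b * a) ^ (2 * k) = z ^ (-k : ℤ) * (b ^ (2 * k : ℤ) * a ^ (2 * k : ℤ)) := by
      rw [pow_mul, hba, ← zpow_natCast, ((hzc _).zpow_left (-1)).mul_zpow, hcommsq.mul_zpow,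
        ← zpow_mul, ← zpow_mul, ← zpow_mul]
      simp
    have h2 : b ^ (2 * k : ℤ) * a ^ (2 * k : ℤ) = a ^ (2 * k : ℤ) * b ^ (2 * k : ℤ) := by
      rw [zpow_mul, zpow_mul]
      exact hcommsq.zpow_zpow k k
    rw [zpow_two, hkey, h1, h2, hzk, ← zpow_two b, zpow_add, zpow_add,
      show (4 * k * -k : ℤ) = -(4 * k * k) by ring]
    simp only [mul_assoc]
  obtain ⟨l, hl⟩ : ∃ l : ℤ, (2 * k + 2 : ℤ) = 4 * l := by
    have h1 : b ^ (2 * k + 2 : ℤ) ∈ Subgroup.zpowers a :=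
      ⟨-(-(4 * k * k) + 2 * k) + 2, by
        simp only
        rw [zpow_add, zpow_neg, hkey2, inv_mul_cancel_left]⟩
    have h2 := (hab.zpow_mem_iff _).1 h1
    rwa [hM4] at h2
  have hfin : a ^ (8 * k : ℤ) = 1 := by
    have h1 : b ^ (2 * k + 2 : ℤ) = a ^ ((4 + 8 * k) * l : ℤ) := by
      rw [hl, zpow_mul, hb4, hzk, ← zpow_add, ← zpow_mul]
      congr 1; ring
    rw [h1, ← zpow_add] at hkey2
    have h2 : -(4 * k * k) + 2 * k + (4 + 8 * k) * l = 2 + (8 * k : ℤ) := by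
      linear_combination (-1 - 2 * (k : ℤ)) * hl
    rw [h2, zpow_add] at hkey2
    exact mul_eq_left.1 hkey2.symm
  have h1 : z ^ 2 = z ^ (2 : ℤ) := by norm_cast
  rw [h1, hzk, ← hfin]
  congr 1; ring

/-- Let the digraph have an automorphism that fixes `1` and maps `a` to `b`, but no
anti-automorphism. Then its arc stabilizers are trivial, and an automorphism of the group exchanges
`a` and `b`. -/
theorem arc_rigid_and_exists_swap (hab : IsMetacyclicPair a b) (hne : a ≠ b)
    (hM : 3 ≤ (Subgroup.zpowers a).index) (hx : ∃ x ∈ arcPerms a b, x 1 = 1 ∧ x a = b)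
    (hrev : ¬ ∃ ψ : Equiv.Perm G, ∀ g h, cayleyArc a b g h → cayleyArc a b (ψ h) (ψ g)) :
    (∀ x ∈ arcPerms a b, x 1 = 1 → x a = a → x = 1) ∧ IsSwapPair a b := by
  have hno : ¬ ∃ y ∈ arcPerms a b, y 1 = 1 ∧ y a = a ∧ y (a * b) = a * a := by
    rintro ⟨y, hy, hy1, hya, hyab⟩
    obtain ⟨hrel, hθ, x, y', h1, h2, h3, h4, h5⟩ :=
      exists_alternating_swaps hab hne hM hx hy hy1 hya hyab
    have hs : IsSwapPair a b := ⟨hab, hθ⟩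
    exact hrev (hs.exists_reversing_perm
      (commutator_sq_of_alternating_swaps hs hM hrel h1 h2 h3 h4 h5))
  have hrigid : ∀ x ∈ arcPerms a b, x 1 = 1 → x a = a → x = 1 := by
    refine fun x => eq_one_of_fixes_arc hab hne ?_
    intro y hy c hc hy1 hyc
    obtain ⟨v, hv, hv1, hva⟩ : ∃ v ∈ arcPerms a b, v 1 = 1 ∧ v a = c := by
      rcases hc with rfl | rfl
      · exact ⟨1, one_mem _, rfl, rfl⟩
      · exact hx
    rcases arcPerms_cases hne hy c with h | h <;> rw [hyc] at h
    · exact h.1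
    refine absurd ⟨v⁻¹ * y * v, mul_mem (mul_mem (inv_mem hv) hy) hv, ?_, ?_, ?_⟩ hno
    · simp only [Equiv.Perm.mul_apply, hv1, hy1, Equiv.Perm.inv_eq_iff_eq]
    · simp only [Equiv.Perm.mul_apply, hva, hyc, Equiv.Perm.inv_eq_iff_eq]
    · rw [Equiv.Perm.mul_apply, Equiv.Perm.mul_apply, Equiv.Perm.inv_eq_iff_eq]
      rcases arcPerms_cases hne hv a with h' | h' <;> rw [hva] at h' <;> rw [h'.1, h'.2]
      · exact h.2
      · exact h.1
  exact ⟨hrigid, hab, exists_swap_of_rigid hab hne hrigid hx⟩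

end TwoArc

/-! ### Parameters of the group -/

section Parameters

variable {G : Type*} [Group G] {a b : G}

theorem zpow_eq_zpow_iff_cast (i j : ℤ) :
    a ^ i = a ^ j ↔ (i : ZMod (orderOf a)) = (j : ZMod (orderOf a)) := by
  rw [zpow_eq_zpow_iff_modEq, ZMod.intCast_eq_intCast_iff]

/-- The relations between the parameters of a metacyclic group with an automorphism exchanging the
two generators, as relations between integers modulo the order of `a`: there are `s`, `t` and `k`
with `[b, a] = a ^ s`, `s = m k` and `b ^ m = a ^ t`. -/
theorem IsSwapPair.exists_parameters (hab : IsSwapPair a b) :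
    ∃ k t C : ℤ, b * a * b⁻¹ * a⁻¹ = a ^ ((Subgroup.zpowers a).index * k) ∧
      b ^ (Subgroup.zpowers a).index = a ^ t ∧
      t = (Subgroup.zpowers a).index * C ∧
      ((Subgroup.zpowers a).index : ZMod (orderOf a)) = C * t ∧
      (t : ZMod (orderOf a)) * k = -((Subgroup.zpowers a).index * k) ∧
      ((Subgroup.zpowers a).index : ZMod (orderOf a)) * ((Subgroup.zpowers a).index * k) = 0 ∧
      (t : ZMod (orderOf a)) * ((Subgroup.zpowers a).index * k) = 0 ∧
      (((Subgroup.zpowers a).index : ZMod (orderOf a)) * k) ^ 2 = 0 ∧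
      (Subgroup.zpowers a).index ∣ orderOf a := by
  obtain ⟨k, hk1, hk2⟩ := hab.exists_commutator_eq
  have hzM := hab.commutator_pow_index
  have hcomm := hab.zpow_mul_zpow
  have hzc := hab.commute_commutator
  set z := b * a * b⁻¹ * a⁻¹
  set m := (Subgroup.zpowers a).index with hm
  obtain ⟨t, ht⟩ : b ^ m ∈ Subgroup.zpowers a := (hab.pow_mem_iff m).2 dvd_rfl
  simp only at ht
  have hbt : a ^ (m : ℤ) = b ^ t :=
    (hab.pow_eq_zpow_iff _ _).2 (by rw [zpow_natCast]; exact ht.symm)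
  obtain ⟨C, hC⟩ : (m : ℤ) ∣ t := by
    rw [hm, ← hab.zpow_mem_iff, ← hbt]
    exact zpow_mem (Subgroup.mem_zpowers a) _
  have hcast : ∀ i j : ℤ, a ^ i = a ^ j ↔ (i : ZMod (orderOf a)) = (j : ZMod (orderOf a)) :=
    zpow_eq_zpow_iff_cast
  refine ⟨k, t, C, hk1, ht.symm, hC, ?_, ?_, ?_, ?_, ?_, ?_⟩
  · have h : a ^ (m : ℤ) = a ^ (C * t) := by
      rw [hbt, hC, zpow_mul, zpow_natCast, ← ht, ← zpow_mul, ← hC, mul_comm]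
    have := (hcast _ _).1 h
    push_cast at this
    exact this
  · have h : a ^ (t * k) = a ^ (-(m * k)) := by
      rw [zpow_neg, ← hk1, hk2, zpow_mul, zpow_mul, ht, zpow_natCast]
    have := (hcast _ _).1 h
    push_cast at this
    exact this
  · have h : a ^ (m * (m * k)) = a ^ (0 : ℤ) := by
      rw [mul_comm, zpow_mul, ← hk1, zpow_natCast, hzM, zpow_zero]
    have := (hcast _ _).1 h
    push_cast at this
    exact this
  · have h : a ^ (t * (m * k)) = a ^ (0 : ℤ) := by
      have h1 := hcomm 1 t
      rw [ht, zpow_one, ((Commute.refl b).pow_right m).eq, one_mul] at h1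
      rw [mul_comm, zpow_mul, ← hk1, mul_eq_right.1 h1.symm, zpow_zero]
    have := (hcast _ _).1 h
    push_cast at this
    exact this
  · have h : a ^ ((m * k) * (m * k)) = a ^ (0 : ℤ) := by
      have h1 := hcomm 1 (m * k)
      rw [← hk1, zpow_one, ((hzc b).symm).eq, one_mul] at h1
      rw [zpow_mul, ← hk1, mul_eq_right.1 h1.symm, zpow_zero]
    have := (hcast _ _).1 h
    push_cast at this
    rw [pow_two]
    exact this
  · rw [hm, ← hab.pow_mem_iff]
    obtain ⟨θ, hθa, -⟩ := hab.exists_swap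
    rw [← hθa, ← map_pow, pow_orderOf_eq_one, map_one]
    exact one_mem _

theorem one_add_pow_of_sq_eq_zero {R : Type*} [CommRing R] {s : R} (hs : s ^ 2 = 0) (i : ℕ) :
    (1 + s) ^ i = 1 + i * s := by
  induction i with
  | zero => simp
  | succ i ih =>
    rw [pow_succ, ih]; push_cast; linear_combination (i : R) * hs

variable [Finite G]

/-- The normal form `a ^ j * b ^ i` identifies the Cayley digraph with the arcs of
`Y(m, n; r, t)`. -/
theorem IsSwapPair.exists_equiv_yArc (hab : IsSwapPair a b) {m n : ℕ}
    (hm : (Subgroup.zpowers a).index = m) (hn : orderOf a = n) (hm2 : 2 ≤ m) {r : (ZMod n)ˣ}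
    {t k : ℤ} (hk : b * a * b⁻¹ * a⁻¹ = a ^ k) (hr : (r : ZMod n) = 1 + k)
    (hk2 : (k : ZMod n) ^ 2 = 0) (ht : b ^ m = a ^ t) :
    ∃ φ : ZMod m × ZMod n ≃ G, ∀ x y, cayleyArc a b (φ x) (φ y) ↔ yArc m n r (t : ZMod n) x y := by
  have hn0 : n ≠ 0 := by rw [← hn]; exact (orderOf_pos a).ne'
  have : NeZero n := ⟨hn0⟩
  have : NeZero m := ⟨by omega⟩
  have hcast : ∀ i j : ℤ, a ^ i = a ^ j ↔ (i : ZMod n) = (j : ZMod n) := by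
    subst hn; exact zpow_eq_zpow_iff_cast
  have hval : ∀ (u : ZMod n) (v : ℤ), (v : ZMod n) = u → a ^ u.val = a ^ v := by
    intro u v h
    rw [← zpow_natCast, hcast]
    simp [h]
  let f : ZMod m × ZMod n → G := fun x => a ^ x.2.val * b ^ x.1.val
  have hinj : Function.Injective f := by
    rintro ⟨i, j⟩ ⟨i', j'⟩ h
    simp only [f] at h
    have h1 : b ^ ((i.val : ℤ) - i'.val) ∈ Subgroup.zpowers a := by
      refine ⟨(j'.val : ℤ) - j.val, ?_⟩
      simp only [zpow_sub, zpow_natCast]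
      rw [(((Commute.refl a).pow_pow _ _).inv_right).eq, inv_mul_eq_iff_eq_mul, ← mul_assoc, h]
      group
    rw [hab.zpow_mem_iff, hm] at h1
    have hi : i = i' := by
      have h2 := (ZMod.intCast_eq_intCast_iff_dvd_sub (i'.val : ℤ) (i.val : ℤ) m).2 h1
      simpa using h2.symm
    subst hi
    have h3 := mul_right_cancel h
    rw [← zpow_natCast, ← zpow_natCast, hcast] at h3
    simpa using h3
  have hbij : Function.Bijective f := by
    rw [Nat.bijective_iff_injective_and_card]
    refine ⟨hinj, ?_⟩
    rw [Nat.card_prod, Nat.card_zmod, Nat.card_zmod, ← Subgroup.card_mul_index (Subgroup.zpowers a),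
      Nat.card_zpowers, hm, hn, mul_comm]
  have hfa : ∀ x : ZMod m × ZMod n, f x * a = f (x.1, x.2 + (r : ZMod n) ^ x.1.val) := by
    intro x
    have h1 := hab.zpow_mul_zpow x.1.val 1
    rw [hk, mul_one, zpow_one, zpow_natCast] at h1
    simp only [f]
    rw [mul_assoc, h1, ← zpow_mul, ← mul_assoc, ← mul_assoc, ← zpow_natCast, ← zpow_add,
      ← zpow_add_one]
    congr 1
    refine (hval _ _ ?_).symm
    rw [hr, one_add_pow_of_sq_eq_zero hk2]
    push_cast
    rw [ZMod.natCast_zmod_val]; ring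
  have hfb : ∀ x : ZMod m × ZMod n,
      f x * b = f (x.1 + 1, x.2 + if x.1.val + 1 = m then (t : ZMod n) else 0) := by
    intro x
    simp only [f]
    rw [mul_assoc, ← pow_succ]
    have h1 : (1 : ZMod m).val = 1 := ZMod.val_one'' (by omega)
    split_ifs with h
    · have h2 : (x.1 + 1).val = 0 := by
        rw [ZMod.val_add, h1, h, Nat.mod_self]
      rw [h, ht, h2, pow_zero, mul_one, ← zpow_natCast, ← zpow_add]
      refine (hval _ _ ?_).symm
      push_cast
      rw [ZMod.natCast_zmod_val]
    · have h2 : (x.1 + 1).val = x.1.val + 1 := by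
        have := x.1.val_lt
        rw [ZMod.val_add, h1, Nat.mod_eq_of_lt (by omega)]
      rw [h2, add_zero]
  refine ⟨Equiv.ofBijective f hbij, fun x y => ?_⟩
  simp only [Equiv.ofBijective_apply, cayleyArc, yArc]
  rw [hfa, hfb, hinj.eq_iff, hinj.eq_iff, Prod.ext_iff, Prod.ext_iff]

end Parameters

section SmallCase

/-- An automorphism of `Y(4, 16; 5, 12)` that fixes the vertex `(0, 0)` and reverses all arcs, the
vertex `(i, j)` being encoded as `16 i + j`. -/
def reversingTableFive : List ℕ :=
    [0, 15, 51, 54, 38, 45, 29, 24, 8, 7, 59, 62, 46, 37, 21, 16, 52, 14, 35, 57, 22, 36, 13, 19,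
    60, 6, 43, 49, 30, 44, 5, 27, 55, 50, 42, 41, 17, 20, 12, 3, 63, 58, 34, 33, 25, 28, 4, 11,
    39, 53, 26, 32, 1, 31, 48, 2, 47, 61, 18, 40, 9, 23, 56, 10]

/-- An automorphism of `Y(4, 16; 13, 12)` that fixes the vertex `(0, 0)` and reverses all arcs, the
vertex `(i, j)` being encoded as `16 i + j`. -/
def reversingTableThirteen : List ℕ :=
    [0, 15, 51, 62, 46, 37, 21, 24, 8, 7, 59, 54, 38, 45, 29, 16, 52, 14, 35, 57, 30, 44, 5, 27,
    60, 6, 43, 49, 22, 36, 13, 19, 63, 50, 42, 41, 17, 28, 4, 11, 55, 58, 34, 33, 25, 20, 12, 3,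
    47, 61, 26, 32, 1, 31, 56, 10, 39, 53, 18, 40, 9, 23, 48, 2]

/-- The self-map of `ZMod 4 × ZMod 16` given by a table. -/
def tableMap (l : List ℕ) (x : ZMod 4 × ZMod 16) : ZMod 4 × ZMod 16 :=
  (((l.getD (16 * x.1.val + x.2.val) 0 / 16 : ℕ) : ZMod 4),
    ((l.getD (16 * x.1.val + x.2.val) 0 : ℕ) : ZMod 16))

set_option maxRecDepth 100000 in
theorem tableMap_spec : ∀ c : Bool, let p : ZMod 16 := if c then 5 else 13
    let l := if c then reversingTableFive else reversingTableThirteen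
    ∀ x : ZMod 4 × ZMod 16, tableMap l (tableMap l (tableMap l (tableMap l x))) = x ∧
      ∀ y, y = (x.1, x.2 + p ^ x.1.val) ∨
          y = (x.1 + 1, x.2 + if x.1.val + 1 = 4 then 12 else 0) →
        tableMap l x = ((tableMap l y).1, (tableMap l y).2 + p ^ (tableMap l y).1.val) ∨
        tableMap l x = ((tableMap l y).1 + 1,
          (tableMap l y).2 + if (tableMap l y).1.val + 1 = 4 then 12 else 0) := by
  -- Eliminating `y` leaves a check over the 64 vertices only.
  simp only [forall_eq_or_imp, forall_eq]
  decide

/-- The graphs `Y(4, 16; 5, 12)` and `Y(4, 16; 13, 12)` have an automorphism reversing all arcs. -/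
theorem exists_reversing_perm_yArc {r : (ZMod 16)ˣ}
    (hr : (r : ZMod 16) = 5 ∨ (r : ZMod 16) = 13) :
    ∃ ψ : Equiv.Perm (ZMod 4 × ZMod 16),
      ∀ x y, yArc 4 16 r 12 x y → yArc 4 16 r 12 (ψ y) (ψ x) := by
  obtain ⟨c, hc⟩ : ∃ c : Bool, (r : ZMod 16) = if c then 5 else 13 := by
    rcases hr with h | h
    · exact ⟨true, h⟩
    · exact ⟨false, h⟩
  have hspec := tableMap_spec c
  simp only [← hc] at hspec
  set F := tableMap (if c then reversingTableFive else reversingTableThirteen)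
  refine ⟨⟨F, fun x => F (F (F x)), fun x => (hspec x).1, fun x => (hspec x).1⟩, fun x y h => ?_⟩
  have := (hspec x).2 y (by simpa only [yArc, Prod.ext_iff] using h)
  simpa only [yArc, Prod.ext_iff, Equiv.coe_fn_mk] using this

end SmallCase

/-! ### Divisibility and parity -/

section Arithmetic

variable {G : Type*} [Group G] {a b : G}

theorem IsSwapPair.mul_inv_pow (hab : IsSwapPair a b) (i : ℕ) :
    (a * b⁻¹) ^ i = a ^ (i : ℤ) * b ^ (-i : ℤ) * (b * a * b⁻¹ * a⁻¹) ^ (-(i.choose 2) : ℤ) := by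
  have hzc := hab.commute_commutator
  have hcomm := hab.zpow_mul_zpow
  set z := b * a * b⁻¹ * a⁻¹
  induction i with
  | zero => simp
  | succ i ih =>
    have h1 := hcomm (-i) 1
    rw [zpow_one, mul_one] at h1
    have h2 : a ^ (i : ℤ) * b ^ (-i : ℤ) * z ^ (-(i.choose 2) : ℤ) * (a * b⁻¹) =
        a ^ (i : ℤ) * (b ^ (-i : ℤ) * a) * b⁻¹ * z ^ (-(i.choose 2) : ℤ) := by
      rw [mul_assoc _ (z ^ _), ((hzc (a * b⁻¹)).zpow_left _).eq]
      simp only [mul_assoc]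
    have h3 : a ^ (i : ℤ) * (z ^ (-i : ℤ) * (a * b ^ (-i : ℤ))) * b⁻¹ =
        a ^ (i : ℤ) * a * (b ^ (-i : ℤ) * b⁻¹) * z ^ (-i : ℤ) := by
      rw [((hzc (a * b ^ (-i : ℤ))).zpow_left _).eq]
      have := ((hzc (b⁻¹)).zpow_left (-i)).eq
      simp only [mul_assoc, this]
    rw [pow_succ, ih, h2, h1, h3, mul_assoc, ← zpow_add, Nat.choose_succ_succ' i 1,
      Nat.choose_one_right, ← zpow_add_one, ← zpow_sub_one]
    push_cast
    congr 2
    · congr 1; ring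
    · ring

variable [Finite G]

/-- The parameters of the group: `r - 1 = m k` is the exponent of the commutator as a power of `a`,
and `b ^ m = a ^ t`. The integer `c` is the quotient `t / m`, and `a` is the residue of `-k`; both
are determined modulo `n / m`. -/
theorem IsSwapPair.exists_yArc_parameters (hab : IsSwapPair a b) {m n : ℕ}
    (hm : (Subgroup.zpowers a).index = m) (hn : orderOf a = n) (h3 : 3 ≤ m)
    (hz2 : (b * a * b⁻¹ * a⁻¹) ^ 2 ≠ 1) :
    (m ∣ n ∧ 2 < n / m) ∧ 3 ≤ n ∧ ∃ (r : (ZMod n)ˣ) (t : ZMod n),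
      (∃ φ : ZMod m × ZMod n ≃ G, ∀ x y, cayleyArc a b (φ x) (φ y) ↔ yArc m n r t x y) ∧
      b * a * b⁻¹ * a⁻¹ = a ^ ((r : ZMod n) - 1).val ∧
      r ^ m = 1 ∧
      (m : ZMod n) * ((r : ZMod n) - 1) = 0 ∧ t * ((r : ZMod n) - 1) = 0 ∧
      ((r : ZMod n) - 1) ^ 2 = 0 ∧
      AddSubgroup.zmultiples (m : ZMod n) = AddSubgroup.zmultiples t ∧
      (∃! c : ℕ, c < n / m ∧ t = (c : ZMod n) * (m : ZMod n) ∧ (m : ZMod n) = (c : ZMod n) * t) ∧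
      (∃! a : ℕ, a < n / m ∧ (a : ZMod n) * t = (r : ZMod n) - 1 ∧
        -((a : ZMod n) * (m : ZMod n)) = (r : ZMod n) - 1) := by
  have hn0 : 0 < n := by rw [← hn]; exact orderOf_pos a
  have : NeZero n := ⟨hn0.ne'⟩
  obtain ⟨k, t, C, hk, ht, hC, hmt, htk, hms, hts, hs2, hmn⟩ := hab.exists_parameters
  rw [hn] at hmt htk hms hts hs2 hmn
  rw [hm] at hk ht hC hmt htk hms hts hs2 hmn
  obtain ⟨d, hd⟩ := hmn
  have hm0 : 0 < m := by omega
  have hdiv : n / m = d := by rw [hd, Nat.mul_div_cancel_left _ hm0]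
  have hmd : (m : ZMod n) * d = 0 := by
    rw [← Nat.cast_mul, ← hd, ZMod.natCast_self]
  have hCZ : (t : ZMod n) = m * C := by rw [hC]; push_cast; rfl
  have hcast : ∀ i j : ℤ, a ^ i = a ^ j ↔ (i : ZMod n) = (j : ZMod n) := by
    subst hn; exact zpow_eq_zpow_iff_cast
  have hz : ∀ i : ℤ, a ^ i = 1 ↔ (n : ℤ) ∣ i := by
    intro i; rw [← hn, orderOf_dvd_iff_zpow_eq_one]
  have hd2 : 2 < d := by
    by_contra hd2
    apply hz2
    rw [hk, ← zpow_natCast, ← zpow_mul, hz, hd]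
    have : 0 < d := Nat.pos_of_ne_zero (by rintro rfl; omega)
    interval_cases d
    · exact ⟨k * 2, by push_cast; ring⟩
    · exact ⟨k, by push_cast; ring⟩
  -- Multiples of `m` are determined by their coefficients modulo `d`.
  have hcoef : ∀ i j : ℤ, (i : ZMod n) * m = j * m ↔ (i : ℤ) ≡ j [ZMOD d] := by
    intro i j
    have h1 : (i : ZMod n) * m = ((i * m : ℤ) : ZMod n) := by push_cast; rfl
    have h2 : (j : ZMod n) * m = ((j * m : ℤ) : ZMod n) := by push_cast; rfl
    rw [h1, h2, ZMod.intCast_eq_intCast_iff, hd, Nat.cast_mul, mul_comm (m : ℤ), mul_comm i,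
      mul_comm j, mul_comm (d : ℤ)]
    exact Int.ModEq.mul_left_cancel_iff' (by exact_mod_cast hm0.ne')
  have hmod : ∀ i : ℤ, ∃ c : ℕ, c < d ∧ (c : ℤ) ≡ i [ZMOD d] := by
    intro i
    have hd' : (d : ℤ) ≠ 0 := by omega
    refine ⟨(i % d).toNat, ?_, ?_⟩
    · have := Int.emod_lt_of_pos i (show (0 : ℤ) < d by omega)
      have := Int.emod_nonneg i hd'
      omega
    · rw [Int.toNat_of_nonneg (Int.emod_nonneg i hd')]
      exact Int.mod_modEq i d
  have huniq : ∀ c c' : ℕ, c < d → c' < d → (c : ZMod n) * m = c' * m → c = c' := by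
    intro c c' hc hc' h
    have h1 := (hcoef c c').1 (by push_cast; exact h)
    have h2 := (Int.natCast_modEq_iff).1 h1
    exact h2.eq_of_lt_of_lt hc hc'
  let r : (ZMod n)ˣ := ⟨1 + m * k, 1 - m * k, by linear_combination -hs2, by
    linear_combination -hs2⟩
  have hr : (r : ZMod n) = 1 + m * k := rfl
  have hr1 : (r : ZMod n) - 1 = m * k := by rw [hr]; ring
  refine ⟨⟨⟨d, hd⟩, by rw [hdiv]; exact hd2⟩, by rw [hd]; nlinarith, r, (t : ℤ), ?_, ?_, ?_, ?_, ?_,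
    ?_, ?_, ?_, ?_⟩
  · exact hab.exists_equiv_yArc hm hn (by omega) hk (by rw [hr]; push_cast; rfl)
      (by push_cast; exact hs2) ht
  · rw [hk, ← zpow_natCast, hcast, hr1]
    push_cast
    rw [ZMod.natCast_zmod_val]
  · ext
    rw [Units.val_pow_eq_pow_val, hr, one_add_pow_of_sq_eq_zero hs2, hms, add_zero, Units.val_one]
  · rw [hr1]; exact hms
  · rw [hr1]; exact hts
  · rw [hr1]; exact hs2
  · apply le_antisymm <;> rw [AddSubgroup.zmultiples_le, AddSubgroup.mem_zmultiples_iff]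
    · exact ⟨C, by rw [zsmul_eq_mul]; exact hmt.symm⟩
    · exact ⟨C, by rw [zsmul_eq_mul, hCZ, mul_comm]⟩
  · rw [hdiv]
    obtain ⟨c, hc, hcC⟩ := hmod C
    have hc1 := (hcoef _ _).2 hcC
    push_cast at hc1
    refine ⟨c, ⟨hc, by rw [hc1, hCZ, mul_comm], ?_⟩, ?_⟩
    · rw [hCZ] at hmt ⊢
      linear_combination hmt - (C : ZMod n) * hc1
    · rintro c' ⟨hc', h1, -⟩
      refine huniq c' c hc' hc ?_
      rw [hc1, ← h1, hCZ, mul_comm]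
  · rw [hdiv]
    obtain ⟨c, hc, hck⟩ := hmod (-k)
    have hc1 := (hcoef _ _).2 hck
    push_cast at hc1
    refine ⟨c, ⟨hc, ?_, ?_⟩, ?_⟩
    · rw [hr1, hCZ]
      rw [hCZ] at htk
      linear_combination (C : ZMod n) * hc1 - htk
    · rw [hr1, hc1]; ring
    · rintro c' ⟨hc', -, h1⟩
      refine huniq c' c hc' hc ?_
      rw [hc1, ← neg_inj, h1, hr1]; ring

/-- Let the commutator `z = a ^ (m k)` be no power of `p = a b⁻¹`. Computing `p ^ m` shows that the
powers `z ^ (k C - 2)`, where `C = m (m - 1) / 2`, and `z ^ 4` do lie in `⟨p⟩`. Hence `z ^ i ∈ ⟨p⟩`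
holds for even `i` only, so that `k C` and the order of `z` are even. -/
theorem IsSwapPair.even_of_commutator_not_mem (hab : IsSwapPair a b) {m n : ℕ}
    (hm : (Subgroup.zpowers a).index = m) (hn : orderOf a = n)
    (hP : b * a * b⁻¹ * a⁻¹ ∉ Subgroup.zpowers (a * b⁻¹)) :
    Even m ∧ Even (n / m) ∧ 8 ∣ n ∧ orderOf (b * a * b⁻¹ * a⁻¹) ∣ m ∧
      orderOf (b * a * b⁻¹ * a⁻¹) ∣ n / m ∧ Even (orderOf (b * a * b⁻¹ * a⁻¹)) := by
  have hn0 : 0 < n := by rw [← hn]; exact orderOf_pos a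
  obtain ⟨k, t, C, hk, ht, hC, hmt, htk, hms, hts, hs2, hmn⟩ := hab.exists_parameters
  have hzm := hab.commutator_pow_index
  have hpm := hab.mul_inv_pow m
  have hcast : ∀ i j : ℤ, a ^ i = a ^ j ↔ (i : ZMod n) = (j : ZMod n) := by
    subst hn; exact zpow_eq_zpow_iff_cast
  rw [hn] at hmt htk hms hts hs2 hmn
  rw [hm] at hk ht hC hmt htk hms hts hs2 hmn hzm
  have hzc := hab.commute_commutator
  set z := b * a * b⁻¹ * a⁻¹
  set P := Subgroup.zpowers (a * b⁻¹)
  obtain ⟨d, hd⟩ := hmn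
  have hm0 : 0 < m := Nat.pos_of_ne_zero (by rintro rfl; omega)
  have hdiv : n / m = d := by rw [hd, Nat.mul_div_cancel_left _ hm0]
  have hzd : z ^ d = 1 := by
    rw [hk, ← zpow_natCast, ← zpow_mul, ← orderOf_dvd_iff_zpow_eq_one, hn, hd]
    exact ⟨k, by push_cast; ring⟩
  have hzkC : z ^ (k * (m.choose 2) - 2 : ℤ) ∈ P := by
    have h1 : ((a * b⁻¹) ^ m) ^ (-k) = z ^ (k * (m.choose 2) - 2 : ℤ) := by
      have h2 : b ^ (-m : ℤ) = a ^ (-t) := by rw [zpow_neg, zpow_natCast, ht, zpow_neg]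
      have h3 : a ^ ((m - t) * (-k)) = a ^ ((m * k) * (-2)) := by
        rw [hcast]; push_cast; linear_combination htk
      rw [hpm, h2, ← zpow_add, ((hzc _).zpow_left _).symm.mul_zpow, ← zpow_mul, ← zpow_mul,
        ← sub_eq_add_neg, h3, zpow_mul, ← hk, ← zpow_add]
      congr 1; ring
    rw [← h1]
    exact zpow_mem (pow_mem (Subgroup.mem_zpowers _) _) _
  have hz4 : z ^ (4 : ℤ) ∈ P := by
    have h1 : z ^ (2 * (m.choose 2) : ℤ) = 1 := by
      have : 2 * (m.choose 2) = m * (m - 1) := by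
        rw [Nat.choose_two_right, Nat.mul_div_cancel' (Nat.even_mul_pred_self m).two_dvd]
      have h2 : (2 * (m.choose 2) : ℤ) = ((m * (m - 1) : ℕ) : ℤ) := by
        rw [← this]; push_cast; rfl
      rw [h2, zpow_natCast, pow_mul, hzm, one_pow]
    have h2 : z ^ (4 : ℤ) = (z ^ (k * (m.choose 2) - 2 : ℤ)) ^ (-2 : ℤ) := by
      rw [← zpow_mul, show (k * (m.choose 2) - 2 : ℤ) * -2 = 4 + 2 * (m.choose 2) * (-k) by ring,
        zpow_add, zpow_mul z (2 * (m.choose 2) : ℤ), h1, one_zpow, mul_one]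
    rw [h2]
    exact zpow_mem hzkC _
  -- An odd power of `z` in `P` would, together with `z ^ 4`, put `z` into `P`.
  have hodd : ∀ i : ℤ, z ^ i ∈ P → Even i := by
    intro i hi
    by_contra hne
    rw [Int.not_even_iff_odd] at hne
    apply hP
    have h1 : z ^ (1 : ℤ) ∈ P := by
      obtain ⟨l, hl⟩ := hne
      have h2 : z ^ (1 : ℤ) = (z ^ i) ^ i * (z ^ (4 : ℤ)) ^ (-(l * l + l)) := by
        rw [← zpow_mul, ← zpow_mul, ← zpow_add]
        congr 1; rw [hl]; ring
      rw [h2]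
      exact mul_mem (zpow_mem hi _) (zpow_mem hz4 _)
    simpa using h1
  have hord : Even (orderOf z) := by
    have := hodd (orderOf z) (by rw [zpow_natCast, pow_orderOf_eq_one]; exact one_mem _)
    exact_mod_cast this
  have hom : orderOf z ∣ m := orderOf_dvd_of_pow_eq_one hzm
  have hod : orderOf z ∣ d := orderOf_dvd_of_pow_eq_one hzd
  have hme : Even m := hord.trans_dvd hom
  have hde : Even d := hord.trans_dvd hod
  rw [hdiv]
  refine ⟨hme, hde, ?_, hom, hod, hord⟩
  obtain ⟨m', hm'⟩ := hme.two_dvd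
  obtain ⟨d', hd'⟩ := hde.two_dvd
  rcases Nat.even_or_odd m' with he | ho
  · obtain ⟨m'', hm''⟩ := he.two_dvd
    exact ⟨m'' * d', by rw [hd, hm', hm'', hd']; ring⟩
  rcases Nat.even_or_odd d' with he | ho'
  · obtain ⟨d'', hd''⟩ := he.two_dvd
    exact ⟨m' * d'', by rw [hd, hm', hd', hd'']; ring⟩
  exfalso
  have hCodd : Odd (m.choose 2 : ℤ) := by
    have : m.choose 2 = m' * (2 * m' - 1) := by
      rw [Nat.choose_two_right, hm', mul_assoc, Nat.mul_div_cancel_left _ two_pos]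
    rw [this]
    have h2 : Odd (2 * m' - 1) := ⟨m' - 1, by have := ho.pos; omega⟩
    exact_mod_cast ho.mul h2
  have hke : Even k := by
    have h1 := hodd _ hzkC
    rw [Int.even_sub, Int.even_mul] at h1
    rcases h1.2 even_two with h | h
    · exact h
    · exact absurd h (Int.not_even_iff_odd.2 hCodd)
  obtain ⟨k', hk'⟩ := hke.two_dvd
  have hzd' : z ^ d' = 1 := by
    rw [hk, ← zpow_natCast, ← zpow_mul, ← orderOf_dvd_iff_zpow_eq_one, hn, hd, hd', hk']
    exact ⟨k', by push_cast; ring⟩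
  exact Nat.not_even_iff_odd.2 ho' (hord.trans_dvd (orderOf_dvd_of_pow_eq_one hzd'))

/-- If `n₁` were odd and squarefree, then `(o / 2) ^ 2`, a divisor of `2 n₁`, would be one. -/
theorem even_or_not_squarefree {m d n₁ o : ℕ} (h : m * d = 8 * n₁) (hom : o ∣ m) (hod : o ∣ d)
    (ho : Even o) (ho2 : ¬ o ∣ 2) : Even n₁ ∨ ¬ Squarefree n₁ := by
  by_contra hcon
  push Not at hcon
  obtain ⟨hodd, hsq⟩ := hcon
  obtain ⟨o', rfl⟩ := ho.two_dvd
  have hsq2 : Squarefree (2 * n₁) := by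
    rw [Nat.squarefree_mul (Nat.coprime_two_left.2 (Nat.not_even_iff_odd.1 hodd))]
    exact ⟨Nat.prime_two.prime.squarefree, hsq⟩
  have h1 : (2 * o') * (2 * o') ∣ 8 * n₁ := by rw [← h]; exact mul_dvd_mul hom hod
  have h2 : o' * o' ∣ 2 * n₁ := by
    rw [show 2 * o' * (2 * o') = 4 * (o' * o') by ring, show 8 * n₁ = 4 * (2 * n₁) by ring] at h1
    exact Nat.dvd_of_mul_dvd_mul_left (by norm_num) h1
  have h3 : o' = 1 := Nat.isUnit_iff.1 (hsq2 o' h2)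
  exact ho2 (by rw [h3, mul_one])

/-- The arithmetic restrictions on the graphs that are not tightly attached. The case `n = 16`
passes the parity conditions and is excluded by the explicit anti-automorphisms of
`exists_reversing_perm_yArc`. -/
theorem IsSwapPair.arithmetic_of_commutator_not_mem (hab : IsSwapPair a b) {m n : ℕ}
    (hm : (Subgroup.zpowers a).index = m) (hn : orderOf a = n) (h3 : 3 ≤ m)
    (hrev : ¬ ∃ ψ : Equiv.Perm G, ∀ g h, cayleyArc a b g h → cayleyArc a b (ψ h) (ψ g))
    (hP : b * a * b⁻¹ * a⁻¹ ∉ Subgroup.zpowers (a * b⁻¹)) :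
    Even m ∧ Even (n / m) ∧ ∃ n₁ : ℕ, n = 8 * n₁ ∧ 2 < n₁ ∧ (Even n₁ ∨ ¬ Squarefree n₁) := by
  obtain ⟨hme, hde, ⟨n₁, hn₁⟩, hom, hod, ho⟩ := hab.even_of_commutator_not_mem hm hn hP
  have hz2 : (b * a * b⁻¹ * a⁻¹) ^ 2 ≠ 1 := fun h => hrev (hab.exists_reversing_perm h)
  obtain ⟨⟨hmn, hd2⟩, hn3, r, t, ⟨φ, hφ⟩, hz, -, hmr, -, -, -, ⟨c, ⟨-, hc, -⟩, -⟩,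
    ⟨α, ⟨-, hα1, hα2⟩, -⟩⟩ := hab.exists_yArc_parameters hm hn h3 hz2
  have hprod : m * (n / m) = 8 * n₁ := by rw [Nat.mul_div_cancel' hmn, hn₁]
  have hns := even_or_not_squarefree hprod hom hod ho
    (fun h => hz2 (orderOf_dvd_iff_pow_eq_one.1 h))
  refine ⟨hme, hde, n₁, hn₁, ?_, hns⟩
  by_contra hlt
  have hn₁2 : n₁ = 2 := by
    have : n₁ ≠ 0 := by rintro rfl; omega
    have : n₁ ≠ 1 := by
      rintro rfl
      rcases hns with h | h
      · exact absurd h (by decide)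
      · exact h squarefree_one
    omega
  subst hn₁2
  have hm4 : m = 4 := by
    obtain ⟨m', rfl⟩ := hme.two_dvd
    obtain ⟨d', hd'⟩ := hde.two_dvd
    rw [hd'] at hprod hd2
    have h1 : m' * d' = 4 := by nlinarith
    have h2 : 2 ≤ m' := by omega
    have h4 : 2 ≤ d' := by omega
    nlinarith
  have hn16 : n = 16 := by omega
  subst hm4 hn16
  -- The parameters `r` and `t` are pinned down by `z ^ 2 ≠ 1`.
  have hr2 : 2 * ((r : ZMod 16) - 1) ≠ 0 := by
    intro h
    apply hz2
    rw [hz, ← pow_mul, ← orderOf_dvd_iff_pow_eq_one, hn, ← ZMod.natCast_eq_zero_iff]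
    push_cast
    rw [ZMod.natCast_zmod_val, mul_comm]
    exact h
  have hfin : ∀ r t c α : ZMod 16, 2 * (r - 1) ≠ 0 → t = c * 4 → α * t = r - 1 →
      -(α * 4) = r - 1 → t = 12 ∧ (r = 5 ∨ r = 13) := by
    have key : ∀ c α : ZMod 16, 2 * (-(α * 4)) ≠ 0 → α * (c * 4) = -(α * 4) →
        c * 4 = 12 ∧ (-(α * 4) = 4 ∨ -(α * 4) = 12) := by decide
    intro r t c α h1 h2 h3 h4
    subst h2
    rw [← h4] at h1 h3
    obtain ⟨h5, h6⟩ := key c α h1 h3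
    refine ⟨h5, ?_⟩
    rw [h4] at h6
    rcases h6 with h6 | h6
    · left; linear_combination h6
    · right; linear_combination h6
  obtain ⟨rfl, hr⟩ := hfin r t c α hr2 (by exact_mod_cast hc) hα1 (by exact_mod_cast hα2)
  obtain ⟨ψ, hψ⟩ := exists_reversing_perm_yArc hr
  refine hrev ⟨(φ.symm.trans ψ).trans φ, fun g h hgh => ?_⟩
  have h1 := hψ (φ.symm g) (φ.symm h) ((hφ _ _).1 (by simpa using hgh))
  simpa using (hφ _ _).2 h1

end Arithmetic

/-! ### Alternating cycles of Cayley digraphs -/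

section AlternatingCycle

variable {G : Type*} [Group G] {a b : G}

/-- The sequence `g, g a, g p, g p a, g p², …` for `p = a b⁻¹`. -/
def alternatingSeq (a b g : G) (i : ℕ) : G :=
  g * (a * b⁻¹) ^ (i / 2) * if Even i then 1 else a

theorem cayleyArc_alternatingSeq (a b g : G) {i j : ℕ} (hi : Even i)
    (hij : j = i + 1 ∨ i = j + 1) :
    cayleyArc a b (alternatingSeq a b g i) (alternatingSeq a b g j) := by
  obtain ⟨k, rfl⟩ := hi.two_dvd
  rcases hij with rfl | h
  · left
    have h1 : (2 * k + 1) / 2 = k := by omega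
    simp [alternatingSeq, h1]
  · right
    obtain ⟨l, rfl⟩ : ∃ l, k = l + 1 := ⟨k - 1, by omega⟩
    obtain rfl : j = 2 * l + 1 := by omega
    have h1 : (2 * l + 1) / 2 = l := by omega
    simp [alternatingSeq, h1, pow_succ, mul_assoc]

variable [Finite G] {V : Type*} {X : SimpleGraph V} {D : V → V → Prop} {e : G ≃ V}

/-- The sequence `alternatingSeq a b g`, traversed backwards, is an alternating cycle. -/
theorem exists_isAlternatingCycle (hne : a ≠ b)
    (hD : ∀ g h, D (e g) (e h) ↔ cayleyArc a b g h) (hX : ∀ u v, X.Adj u v ↔ D u v ∨ D v u)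
    (ha : a ∉ Subgroup.zpowers (a * b⁻¹)) (g : G) :
    ∃ (v : V) (C : X.Walk v v), IsAlternatingCycle D C ∧ v = e g := by
  set p := a * b⁻¹
  set o := orderOf p with ho
  have hp1 : p ≠ 1 := fun h => hne (mul_inv_eq_one.1 h)
  have ho2 : 2 ≤ o := by
    have h1 : 0 < o := orderOf_pos p
    have h2 : o ≠ 1 := fun h => hp1 (orderOf_eq_one_iff.1 h)
    omega
  obtain ⟨N, hN⟩ : ∃ N, 2 * o = N + 3 := ⟨2 * o - 3, by omega⟩
  have hNe : Even (N + 3) := hN ▸ even_two_mul o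
  let F : ℕ → G := alternatingSeq a b g
  have hFN : F (N + 3) = F 0 := by
    have h1 : 2 * o / 2 = o := by omega
    simp only [F, alternatingSeq, ← hN, even_two_mul, if_true, h1]
    rw [pow_orderOf_eq_one]; simp
  have hFmod : ∀ i, i ≤ N + 3 → F (i % (N + 3)) = F i := by
    intro i hi
    rcases hi.lt_or_eq with h | rfl
    · rw [Nat.mod_eq_of_lt h]
    · rw [Nat.mod_self, hFN]
  have hadj : ∀ i, X.Adj (e (F i)) (e (F (i + 1))) := by
    intro i
    rw [hX, hD, hD]
    rcases Nat.even_or_odd i with h | h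
    · exact Or.inl (cayleyArc_alternatingSeq a b g h (Or.inl rfl))
    · exact Or.inr (cayleyArc_alternatingSeq a b g h.add_one (Or.inr rfl))
  have hinj : ∀ i j, i < N + 3 → j < N + 3 → F i = F j → i = j := by
    intro i j hi hj h
    simp only [F, alternatingSeq, mul_assoc, mul_right_inj] at h
    have hpow : ∀ {s t : ℕ}, s < N + 3 → t < N + 3 → p ^ (s / 2) = p ^ (t / 2) →
        s / 2 = t / 2 := fun hs ht h => pow_injOn_Iio_orderOf
      (by simp only [Set.mem_Iio]; omega) (by simp only [Set.mem_Iio]; omega) h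
    rcases Nat.even_or_odd i with hi' | hi' <;> rcases Nat.even_or_odd j with hj' | hj'
    · rw [if_pos hi', if_pos hj', mul_one, mul_one] at h
      have := hpow hi hj h
      obtain ⟨s, rfl⟩ := hi'; obtain ⟨t, rfl⟩ := hj'
      omega
    · rw [if_pos hi', if_neg (Nat.not_even_iff_odd.2 hj'), mul_one] at h
      refine absurd ?_ ha
      rw [← inv_mul_eq_iff_eq_mul] at h
      rw [← h]
      exact mul_mem (inv_mem (pow_mem (Subgroup.mem_zpowers _) _))
        (pow_mem (Subgroup.mem_zpowers _) _)
    · rw [if_pos hj', if_neg (Nat.not_even_iff_odd.2 hi'), mul_one] at h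
      refine absurd ?_ ha
      rw [eq_comm, ← inv_mul_eq_iff_eq_mul] at h
      rw [← h]
      exact mul_mem (inv_mem (pow_mem (Subgroup.mem_zpowers _) _))
        (pow_mem (Subgroup.mem_zpowers _) _)
    · rw [if_neg (Nat.not_even_iff_odd.2 hi'), if_neg (Nat.not_even_iff_odd.2 hj')] at h
      have := hpow hi hj (mul_right_cancel h)
      obtain ⟨s, rfl⟩ := hi'; obtain ⟨t, rfl⟩ := hj'
      omega
  have hsucc : ∀ i j : Fin (N + 3), j - i = 1 → F j = F (i + 1) := by
    intro i j h
    have hj : j = i + 1 := by rw [← h]; abel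
    rw [hj, Fin.val_add, Fin.val_one, hFmod _ (by omega)]
  let f : SimpleGraph.cycleGraph (N + 3) →g X :=
    { toFun := fun i => e (F i.val)
      map_rel' := by
        intro i j hij
        rcases SimpleGraph.cycleGraph_adj.1 hij with h | h
        · rw [hsucc _ _ h]; exact (hadj _).symm
        · rw [hsucc _ _ h]; exact hadj _ }
  have hfinj : Function.Injective f := fun i j h =>
    Fin.ext (hinj i j i.isLt j.isLt (e.injective h))
  have hvert : ∀ i, i ≤ N + 3 →
      (((SimpleGraph.cycleGraph.cycle N).map f).getVert i) = e (F (N + 3 - i)) := by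
    intro i hi
    rw [SimpleGraph.Walk.getVert_map, SimpleGraph.cycleGraph.getVert_cycle hi]
    change e (F _) = _
    rw [hFmod _ (by omega)]
  have hlen : ((SimpleGraph.cycleGraph.cycle N).map f).length = N + 3 := by
    rw [SimpleGraph.Walk.length_map, SimpleGraph.cycleGraph.length_cycle]
  refine ⟨_, (SimpleGraph.cycleGraph.cycle N).map f, ⟨?_, ?_, ?_⟩, ?_⟩
  · exact (SimpleGraph.Walk.isCycle_map_iff_of_injective hfinj).2
      SimpleGraph.cycleGraph.isCycle_cycle
  · rw [hlen]; exact hNe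
  · rw [hlen]
    intro i hi
    rw [hvert _ hi.le, hvert _ hi, hD, hD]
    constructor
    · intro h
      exact cayleyArc_alternatingSeq a b g ((Nat.even_sub hi.le).2 (by simp [h, hNe]))
        (Or.inr (by omega))
    · intro h
      exact cayleyArc_alternatingSeq a b g ((Nat.even_sub hi).2 (by simp [h.add_one, hNe]))
        (Or.inl (by omega))
  · change e (F 0) = e g
    simp [F, alternatingSeq]

/-- The vertices of an alternating cycle are determined by the first tail `g` and by the letter `s`
read along the first arc. -/
theorem IsAlternatingCycle.exists_getVert (hD : ∀ g h, D (e g) (e h) ↔ cayleyArc a b g h)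
    {v : V} {C : X.Walk v v} (hC : IsAlternatingCycle D C) :
    ∃ s s' : G, (s = a ∧ s' = b ∨ s = b ∧ s' = a) ∧
      (∀ i, 2 * i ≤ C.length → C.getVert (2 * i) = e (e.symm v * (s * s'⁻¹) ^ i)) ∧
      (∀ i, 2 * i + 1 ≤ C.length →
        C.getVert (2 * i + 1) = e (e.symm v * (s * s'⁻¹) ^ i * s)) ∧
      C.length = 2 * orderOf (s * s'⁻¹) := by
  obtain ⟨hcyc, ⟨l, hl⟩, halt⟩ := hC
  have hlen := hcyc.three_le_length
  set g := e.symm v with hg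
  have hv0 : C.getVert 0 = e g := by simp [hg]
  have hfirst : cayleyArc a b g (e.symm (C.getVert 1)) := by
    have := (halt 0 (by omega)).1 (by simp)
    rw [hv0, ← e.apply_symm_apply (C.getVert (0 + 1)), hD] at this
    exact this
  obtain ⟨s, s', hss, hs⟩ : ∃ s s' : G, (s = a ∧ s' = b ∨ s = b ∧ s' = a) ∧
      C.getVert 1 = e (g * s) := by
    rcases hfirst with h | h
    · exact ⟨a, b, by simp, by rw [← h]; simp⟩
    · exact ⟨b, a, by simp, by rw [← h]; simp⟩
  have harc : ∀ x y : G, cayleyArc a b x y → y = x * s ∨ y = x * s' := by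
    intro x y hxy
    rcases hss with ⟨rfl, rfl⟩ | ⟨rfl, rfl⟩
    · exact hxy
    · exact hxy.symm
  have hmain : ∀ i, (2 * i ≤ C.length → C.getVert (2 * i) = e (g * (s * s'⁻¹) ^ i)) ∧
      (2 * i + 1 ≤ C.length → C.getVert (2 * i + 1) = e (g * (s * s'⁻¹) ^ i * s)) := by
    intro i
    induction i with
    | zero => exact ⟨fun _ => by simpa using hv0, fun _ => by simpa using hs⟩
    | succ i ih =>
      have heven : 2 * (i + 1) ≤ C.length →
          C.getVert (2 * (i + 1)) = e (g * (s * s'⁻¹) ^ (i + 1)) := by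
        intro hi
        have h1 := (halt (2 * i + 1) (by omega)).2 ⟨i, rfl⟩
        rw [ih.2 (by omega), ← e.apply_symm_apply (C.getVert (2 * i + 1 + 1)), hD] at h1
        rcases harc _ _ h1 with h | h
        · exfalso
          have h2 : C.getVert (2 * i + 1 + 1) = C.getVert (2 * i) := by
            rw [ih.1 (by omega), mul_right_cancel h, e.apply_symm_apply]
          rcases Nat.eq_zero_or_pos i with rfl | hpos
          · have := hcyc.getVert_injOn' (by simp only [Set.mem_ofPred_eq]; omega)
              (by simp only [Set.mem_ofPred_eq]; omega) h2
            omega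
          · have := hcyc.getVert_injOn (by simp only [Set.mem_ofPred_eq]; omega)
              (by simp only [Set.mem_ofPred_eq]; omega) h2
            omega
        · rw [mul_add, mul_one, pow_succ, ← mul_assoc, ← mul_assoc, h, mul_inv_cancel_right,
            e.apply_symm_apply]
      refine ⟨heven, fun hi => ?_⟩
      have h1 := (halt (2 * (i + 1)) (by omega)).1 (even_two_mul _)
      rw [heven (by omega), ← e.apply_symm_apply (C.getVert (2 * (i + 1) + 1)), hD] at h1
      rcases harc _ _ h1 with h | h
      · rw [← h, e.apply_symm_apply]
      · exfalso
        have h2 : C.getVert (2 * (i + 1) + 1) = C.getVert (2 * i + 1) := by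
          rw [← e.apply_symm_apply (C.getVert (2 * (i + 1) + 1)), h, ih.2 (by omega), pow_succ,
            ← mul_assoc, ← mul_assoc, inv_mul_cancel_right]
        have := hcyc.getVert_injOn (by simp only [Set.mem_ofPred_eq]; omega)
          (by simp only [Set.mem_ofPred_eq]; omega) h2
        omega
  refine ⟨s, s', hss, fun i => (hmain i).1, fun i => (hmain i).2, ?_⟩
  have hpos := orderOf_pos (s * s'⁻¹)
  have hdvd : orderOf (s * s'⁻¹) ∣ l := by
    rw [orderOf_dvd_iff_pow_eq_one]
    have h1 := (hmain l).1 (by omega)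
    rw [show 2 * l = C.length by omega, SimpleGraph.Walk.getVert_length,
      ← e.symm_apply_eq, ← hg] at h1
    exact mul_eq_left.1 h1.symm
  have hle : l ≤ orderOf (s * s'⁻¹) := by
    by_contra hlt
    have h1 := (hmain (orderOf (s * s'⁻¹))).1 (by omega)
    rw [pow_orderOf_eq_one, mul_one, ← hv0] at h1
    have := hcyc.getVert_injOn' (by simp only [Set.mem_ofPred_eq]; omega)
      (by simp only [Set.mem_ofPred_eq]; omega) h1
    omega
  have := Nat.le_of_dvd (by omega) hdvd
  omega

/-- When `P = ⟨a b⁻¹⟩` is normal, the tails of an alternating cycle form a coset of `P`, and its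
heads form the next coset. -/
theorem IsAlternatingCycle.exists_coset (hD : ∀ g h, D (e g) (e h) ↔ cayleyArc a b g h)
    [hP : (Subgroup.zpowers (a * b⁻¹)).Normal] {v : V} {C : X.Walk v v}
    (hC : IsAlternatingCycle D C) :
    C.length = 2 * orderOf (a * b⁻¹) ∧
    (∀ h : G, e h ∈ C.support ↔ (h : G ⧸ Subgroup.zpowers (a * b⁻¹)) = (e.symm v : G) ∨
      (h : G ⧸ Subgroup.zpowers (a * b⁻¹)) = (e.symm v : G) * (a : G)) ∧
    ∀ u w : V, C.toSubgraph.Adj u w ↔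
      ((e.symm u : G ⧸ Subgroup.zpowers (a * b⁻¹)) = (e.symm v : G) ∧ D u w) ∨
      ((e.symm w : G ⧸ Subgroup.zpowers (a * b⁻¹)) = (e.symm v : G) ∧ D w u) := by
  obtain ⟨s, s', hss, heven, hodd, hlen⟩ := hC.exists_getVert hD
  obtain ⟨hcyc, -, halt⟩ := hC
  set P := Subgroup.zpowers (a * b⁻¹) with hPdef
  set g := e.symm v with hg
  have hPs : P = Subgroup.zpowers (s * s'⁻¹) := by
    rcases hss with ⟨rfl, rfl⟩ | ⟨rfl, rfl⟩
    · rfl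
    · rw [hPdef, ← Subgroup.zpowers_inv]; congr 1; group
  have hord : orderOf (s * s'⁻¹) = orderOf (a * b⁻¹) := by
    rw [← Nat.card_zpowers, ← Nat.card_zpowers, ← hPs]
  have hab : (a : G ⧸ P) = b := by
    have h1 : a * b⁻¹ ∈ P := Subgroup.mem_zpowers _
    have h2 := (QuotientGroup.eq_one_iff (N := P) _).2 h1
    rw [QuotientGroup.mk_mul, QuotientGroup.mk_inv, mul_inv_eq_one] at h2
    exact h2
  have hs : (s : G ⧸ P) = a := by rcases hss with ⟨rfl, rfl⟩ | ⟨rfl, rfl⟩ <;> simp [hab]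
  have hq : ∀ i : ℕ, (((s * s'⁻¹) ^ i : G) : G ⧸ P) = 1 := by
    intro i
    rw [QuotientGroup.eq_one_iff, hPs]
    exact pow_mem (Subgroup.mem_zpowers _) _
  have htail : ∀ h : G, (h : G ⧸ P) = g → ∃ i < orderOf (s * s'⁻¹), h = g * (s * s'⁻¹) ^ i := by
    intro h hh
    have h1 : g⁻¹ * h ∈ Subgroup.zpowers (s * s'⁻¹) := by
      rw [← hPs]; exact QuotientGroup.eq.1 hh.symm
    classical
    rw [mem_zpowers_iff_mem_range_orderOf, Finset.mem_image] at h1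
    obtain ⟨i, hi, hi'⟩ := h1
    exact ⟨i, Finset.mem_range.1 hi, by rw [hi']; group⟩
  refine ⟨by rw [hlen, hord], ?_, ?_⟩
  · intro h
    rw [SimpleGraph.Walk.mem_support_iff_exists_getVert]
    constructor
    · rintro ⟨i, hi, hi'⟩
      rcases Nat.even_or_odd' i with ⟨j, rfl | rfl⟩
      · left
        rw [heven j hi', e.apply_eq_iff_eq] at hi
        rw [← hi, QuotientGroup.mk_mul, hq, mul_one]
      · right
        rw [hodd j hi', e.apply_eq_iff_eq] at hi
        rw [← hi, QuotientGroup.mk_mul, QuotientGroup.mk_mul, hq, mul_one, hs]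
    · rintro (h1 | h1)
      · obtain ⟨i, hi, rfl⟩ := htail h h1
        exact ⟨2 * i, heven i (by omega), by omega⟩
      · obtain ⟨i, hi, hi'⟩ := htail (h * s⁻¹) (by
          rw [QuotientGroup.mk_mul, QuotientGroup.mk_inv, hs, h1, mul_inv_cancel_right])
        rw [mul_inv_eq_iff_eq_mul] at hi'
        exact ⟨2 * i + 1, by rw [hodd i (by omega), hi'], by omega⟩
  · have key : ∀ u w : V, (e.symm u : G ⧸ P) = g → D u w → C.toSubgraph.Adj u w := by
      intro u w hu huw
      rw [SimpleGraph.Walk.toSubgraph_adj_iff]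
      obtain ⟨i, hi, hi'⟩ := htail _ hu
      have hu' : u = e (g * (s * s'⁻¹) ^ i) := by rw [← hi', e.apply_symm_apply]
      have hw : e.symm w = g * (s * s'⁻¹) ^ i * s ∨ e.symm w = g * (s * s'⁻¹) ^ i * s' := by
        rw [hu', ← e.apply_symm_apply w, hD] at huw
        rcases hss with ⟨rfl, rfl⟩ | ⟨rfl, rfl⟩
        · exact huw
        · exact huw.symm
      rcases hw with hw | hw <;> rw [e.symm_apply_eq] at hw
      · exact ⟨2 * i, by rw [heven i (by omega), hodd i (by omega), hu', hw], by omega⟩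
      · -- The arc is the edge that precedes the tail `u` on the cycle, the index of which must
        -- therefore be taken positive.
        obtain ⟨j, hj, hj'⟩ : ∃ j, j < orderOf (s * s'⁻¹) ∧
            g * (s * s'⁻¹) ^ i = g * (s * s'⁻¹) ^ (j + 1) := by
          rcases i with _ | i
          · refine ⟨orderOf (s * s'⁻¹) - 1, by omega, ?_⟩
            rw [Nat.sub_add_cancel (by omega), pow_orderOf_eq_one, pow_zero]
          · exact ⟨i, by omega, rfl⟩
        refine ⟨2 * j + 1, ?_, by omega⟩
        rw [hj'] at hu' hw
        rw [hodd j (by omega), show 2 * j + 1 + 1 = 2 * (j + 1) by ring, heven (j + 1) (by omega),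
          Sym2.eq_swap, hu', hw, pow_succ]
        congr 2
        group
    intro u w
    constructor
    · rw [SimpleGraph.Walk.toSubgraph_adj_iff]
      rintro ⟨i, hi, hi'⟩
      rcases Nat.even_or_odd' i with ⟨j, rfl | rfl⟩
      · have h1 := (halt _ hi').1 (even_two_mul j)
        have h2 := heven j hi'.le
        have h3 : ((e.symm (C.getVert (2 * j)) : G) : G ⧸ P) = g := by
          rw [h2, e.symm_apply_apply, QuotientGroup.mk_mul, hq, mul_one]
        rcases Sym2.eq_iff.1 hi with ⟨h4, h5⟩ | ⟨h4, h5⟩ <;> rw [h4] at h1 h3 <;> rw [h5] at h1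
        · exact Or.inl ⟨h3, h1⟩
        · exact Or.inr ⟨h3, h1⟩
      · have h1 := (halt _ hi').2 ⟨j, rfl⟩
        have h2 := heven (j + 1) (by omega)
        have h3 : ((e.symm (C.getVert (2 * j + 1 + 1)) : G) : G ⧸ P) = g := by
          rw [show 2 * j + 1 + 1 = 2 * (j + 1) by ring, h2, e.symm_apply_apply,
            QuotientGroup.mk_mul, hq, mul_one]
        rcases Sym2.eq_iff.1 hi with ⟨h4, h5⟩ | ⟨h4, h5⟩ <;> rw [h5] at h1 h3 <;> rw [h4] at h1
        · exact Or.inr ⟨h3, h1⟩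
        · exact Or.inl ⟨h3, h1⟩
    · rintro (⟨h1, h2⟩ | ⟨h1, h2⟩)
      · exact key u w h1 h2
      · exact (key w u h1 h2).symm

/-- Two distinct pairs of consecutive elements `S, S A` and `T, T A` have at most one element in
common if `A ^ 2 ≠ 1`. -/
theorem eq_of_consecutive {Q : Type*} [Group Q] {A S T Y Z : Q} (hA : A * A ≠ 1) (hST : S ≠ T)
    (hY : Y = S ∨ Y = S * A) (hY' : Y = T ∨ Y = T * A) (hZ : Z = S ∨ Z = S * A)
    (hZ' : Z = T ∨ Z = T * A) : Y = Z := by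
  have h1 : ¬ (S = T * A ∧ S * A = T) := by
    rintro ⟨rfl, h⟩
    rw [mul_assoc, mul_eq_left] at h
    exact hA h
  have h2 : S * A ≠ T * A := fun h => hST (mul_right_cancel h)
  grind

/-- If `P = ⟨a b⁻¹⟩` is normal and contains neither `a` nor `a ^ 2`, then any two adjacent
alternating cycles meet in a single coset of `P`. -/
theorem hasRadius_and_hasAttachmentNumber (hne : a ≠ b)
    (hD : ∀ g h, D (e g) (e h) ↔ cayleyArc a b g h) (hX : ∀ u v, X.Adj u v ↔ D u v ∨ D v u)
    [hP : (Subgroup.zpowers (a * b⁻¹)).Normal] (ha : a ∉ Subgroup.zpowers (a * b⁻¹))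
    (ha2 : a * a ∉ Subgroup.zpowers (a * b⁻¹)) :
    HasRadius X D (orderOf (a * b⁻¹)) ∧ HasAttachmentNumber X D (orderOf (a * b⁻¹)) := by
  have hcycle := exists_isAlternatingCycle (X := X) hne hD hX ha
  have hcoset := fun {v : V} {C : X.Walk v v} (hC : IsAlternatingCycle D C) =>
    hC.exists_coset hD
  set P := Subgroup.zpowers (a * b⁻¹)
  have hA : ((a : G) : G ⧸ P) ≠ 1 := fun h => ha ((QuotientGroup.eq_one_iff a).1 h)
  have hA2 : ((a : G) : G ⧸ P) * (a : G) ≠ 1 := fun h => ha2 ((QuotientGroup.eq_one_iff _).1 h)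
  refine ⟨⟨?_, fun v C hC => (hcoset hC).1⟩, ?_, ?_⟩
  · obtain ⟨v, C, hC, -⟩ := hcycle 1
    exact ⟨v, C, hC⟩
  · obtain ⟨v, C, hC, rfl⟩ := hcycle 1
    obtain ⟨w, C', hC', rfl⟩ := hcycle a
    obtain ⟨-, h1, -⟩ := hcoset hC
    obtain ⟨-, h1', -⟩ := hcoset hC'
    simp only [e.symm_apply_apply] at h1 h1'
    refine ⟨_, _, C, C', hC, hC', ?_, e a, (h1 a).2 (Or.inr (by simp)), (h1' a).2 (Or.inl rfl)⟩
    intro heq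
    have h2 : e 1 ∈ C.support := (h1 1).2 (Or.inl rfl)
    rw [← SimpleGraph.Walk.mem_verts_toSubgraph, heq, SimpleGraph.Walk.mem_verts_toSubgraph,
      h1'] at h2
    rcases h2 with h2 | h2
    · exact hA h2.symm
    · exact hA2 h2.symm
  · rintro v w C C' ⟨hC, hC', hneq, x, hx, hx'⟩
    obtain ⟨-, h1, h2⟩ := hcoset hC
    obtain ⟨-, h1', h2'⟩ := hcoset hC'
    have hcase : ((e.symm v : G) : G ⧸ P) ≠ (e.symm w : G) := by
      intro h
      apply hneq
      ext u u'
      · rw [SimpleGraph.Walk.mem_verts_toSubgraph, SimpleGraph.Walk.mem_verts_toSubgraph,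
          ← e.apply_symm_apply u, h1, h1', h]
      · rw [h2, h2', h]
    -- The common vertices form the coset of the common vertex `x`.
    have hset : {y | y ∈ C.support ∧ y ∈ C'.support} =
        (fun q : G => e (e.symm x * q)) '' (P : Set G) := by
      rw [← e.apply_symm_apply x, h1] at hx
      rw [← e.apply_symm_apply x, h1'] at hx'
      have hiff : ∀ y : V, (y ∈ C.support ∧ y ∈ C'.support) ↔
          ((e.symm y : G) : G ⧸ P) = (e.symm x : G) := by
        intro y
        rw [← e.apply_symm_apply y, h1, h1', e.symm_apply_apply]
        constructor
        · rintro ⟨hy, hy'⟩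
          exact eq_of_consecutive hA2 hcase hy hy' hx hx'
        · intro h
          rw [h]
          exact ⟨hx, hx'⟩
      ext y
      rw [Set.mem_ofPred_eq, hiff, Set.mem_image]
      constructor
      · intro h
        exact ⟨(e.symm x)⁻¹ * e.symm y, QuotientGroup.eq.1 h.symm, by simp⟩
      · rintro ⟨q, hq, rfl⟩
        rw [e.symm_apply_apply, QuotientGroup.mk_mul, (QuotientGroup.eq_one_iff q).2 hq, mul_one]
    have hinj : Function.Injective (fun q : G => e (e.symm x * q)) :=
      e.injective.comp (mul_right_injective _)
    rw [hset, Set.ncard_image_of_injective _ hinj, ← Nat.card_zpowers]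
    rfl

end AlternatingCycle

/-! ### Tight attachment -/

section Tight

variable {G : Type*} [Group G] [Finite G] {a b : G}

/-- If the commutator `z` is a power of `p = a b⁻¹`, then `P = ⟨p⟩` is normal, since both
conjugates `a⁻¹ p a` and `b⁻¹ p b` are equal to `z⁻¹ p`. The automorphism exchanging `a` and `b`
inverts `P`, so that `a ^ 2 ∈ P` would imply `b ^ 2 = a ^ (-2)`. -/
theorem IsSwapPair.normal_of_commutator_mem (hab : IsSwapPair a b)
    (h3 : 3 ≤ (Subgroup.zpowers a).index)
    (hz : b * a * b⁻¹ * a⁻¹ ∈ Subgroup.zpowers (a * b⁻¹)) :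
    (Subgroup.zpowers (a * b⁻¹)).Normal ∧ a ∉ Subgroup.zpowers (a * b⁻¹) ∧
      a * a ∉ Subgroup.zpowers (a * b⁻¹) ∧
      Subgroup.zpowers (a⁻¹ * b⁻¹⁻¹) = Subgroup.zpowers (a * b⁻¹) := by
  have hzc := hab.commute_commutator
  set z := b * a * b⁻¹ * a⁻¹ with hzdef
  set P := Subgroup.zpowers (a * b⁻¹) with hPdef
  have hq : b⁻¹ * a ∈ P := by
    have h1 : b⁻¹ * a = z⁻¹ * (a * b⁻¹) := by
      have h2 : b⁻¹ * z * b = z := by rw [mul_assoc, (hzc b).eq, inv_mul_cancel_left]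
      rw [← h2, hzdef]; group
    rw [h1]
    exact mul_mem (inv_mem hz) (Subgroup.mem_zpowers _)
  have hnorm : ∀ c : G, c⁻¹ * (a * b⁻¹) * c = b⁻¹ * a → c ∈ Subgroup.normalizer (P : Set G) := by
    intro c hc
    rw [← inv_mem_iff]
    refine Subgroup.mem_normalizer_fintype (fun x hx => ?_)
    obtain ⟨i, rfl⟩ := hx
    have h1 : c⁻¹ * (a * b⁻¹) ^ i * c⁻¹⁻¹ = (b⁻¹ * a) ^ i := by
      rw [← conj_zpow, inv_inv, hc]
    simp only
    rw [h1]
    exact zpow_mem hq i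
  have hN : P.Normal := by
    rw [← Subgroup.normalizer_eq_top_iff, eq_top_iff, ← hab.closure_eq, Subgroup.closure_le]
    rintro x (rfl | rfl)
    · exact hnorm _ (by group)
    · exact hnorm _ (by group)
  have ha2 : a * a ∉ P := by
    rintro ⟨i, hi⟩
    obtain ⟨θ, hθa, hθb⟩ := hab.exists_swap
    have h1 : b * b = (a * a)⁻¹ := by
      have h2 := congrArg θ hi
      simp only [map_zpow, map_mul, map_inv, hθa, hθb] at h2
      simp only at hi
      rw [← h2, ← hi, ← inv_zpow]
      congr 1; group
    have h2 : b ^ 2 ∈ Subgroup.zpowers a := by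
      rw [pow_two, h1]
      exact inv_mem (mul_mem (Subgroup.mem_zpowers a) (Subgroup.mem_zpowers a))
    have h4 := Nat.le_of_dvd two_pos ((hab.pow_mem_iff 2).1 h2)
    omega
  refine ⟨hN, fun h => ha2 (mul_mem h h), ha2, ?_⟩
  have h1 : a⁻¹ * b⁻¹⁻¹ = (b⁻¹ * a)⁻¹ := by group
  rw [h1, Subgroup.zpowers_inv]
  apply Subgroup.eq_of_le_of_card_ge
  · rwa [Subgroup.zpowers_le]
  · rw [hPdef, Nat.card_zpowers, Nat.card_zpowers]
    have h2 : b⁻¹ * a = MulAut.conj b⁻¹ (a * b⁻¹) := by rw [MulAut.conj_apply]; group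
    rw [h2, MulEquiv.orderOf_eq]

end Tight

/-! ### Orientations and orbits of a weak metacirculant -/

section Orientation

variable {V : Type*} {X : SimpleGraph V} {D : V → V → Prop}

theorem IsAutOrientation.map_iff (hD : IsAutOrientation X D) (x : X ≃g X) (u w : V) :
    D (x u) (x w) ↔ D u w := by
  obtain ⟨p, q, -, hD⟩ := hD
  rw [hD, hD]
  constructor
  · rintro ⟨g, h1, h2⟩
    exact ⟨x⁻¹ * g, by rw [RelIso.mul_apply, h1, RelIso.inv_apply_self],
      by rw [RelIso.mul_apply, h2, RelIso.inv_apply_self]⟩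
  · rintro ⟨g, h1, h2⟩
    exact ⟨x * g, by rw [RelIso.mul_apply, h1], by rw [RelIso.mul_apply, h2]⟩

theorem IsAutOrientation.exists_map (hD : IsAutOrientation X D) {u w u' w' : V} (h : D u w)
    (h' : D u' w') : ∃ x : X ≃g X, x u = u' ∧ x w = w' := by
  obtain ⟨p, q, -, hD⟩ := hD
  rw [hD] at h h'
  obtain ⟨g, h1, h2⟩ := h
  obtain ⟨g', h1', h2'⟩ := h'
  exact ⟨g' * g⁻¹, by rw [RelIso.mul_apply, ← h1, RelIso.inv_apply_self, h1'],
    by rw [RelIso.mul_apply, ← h2, RelIso.inv_apply_self, h2']⟩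

theorem IsAutOrientation.adj_iff (hX : IsHalfArcTransitive X) (hD : IsAutOrientation X D)
    (u w : V) : X.Adj u w ↔ D u w ∨ D w u := by
  obtain ⟨p, q, hpq, hD⟩ := hD
  rw [hD, hD]
  constructor
  · intro h
    obtain ⟨g, hg⟩ := hX.edgeTransitive p q u w hpq h
    rcases Sym2.eq_iff.1 hg with h | h
    · exact Or.inl ⟨g, h⟩
    · exact Or.inr ⟨g, h⟩
  · rintro (⟨g, rfl, rfl⟩ | ⟨g, rfl, rfl⟩)
    · exact g.map_adj_iff.2 hpq
    · exact (g.map_adj_iff.2 hpq).symm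

theorem IsAutOrientation.asymm (hX : IsHalfArcTransitive X) (hD : IsAutOrientation X D) {u w : V}
    (h : D u w) : ¬ D w u := by
  intro h'
  have hsymm : ∀ p q, D p q → D q p := by
    intro p q hpq
    obtain ⟨x, rfl, rfl⟩ := hD.exists_map h hpq
    exact (hD.map_iff x _ _).2 h'
  refine hX.not_arcTransitive fun p q p' q' hpq hpq' => ?_
  have h1 : D p q := ((hD.adj_iff hX p q).1 hpq).elim id (hsymm q p)
  have h2 : D p' q' := ((hD.adj_iff hX p' q').1 hpq').elim id (hsymm q' p')
  exact hD.exists_map h1 h2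

/-- A half-arc-transitive graph has only two orientations of this kind, opposite to each other. -/
theorem IsAutOrientation.eq_or_eq_reverse (hX : IsHalfArcTransitive X) (hD : IsAutOrientation X D)
    {D' : V → V → Prop} (hD' : IsAutOrientation X D') :
    (∀ u w, D' u w ↔ D u w) ∨ ∀ u w, D' u w ↔ D w u := by
  obtain ⟨p, q, hpq, hD'⟩ := hD'
  rcases (hD.adj_iff hX p q).1 hpq with h | h
  · left
    intro u w
    rw [hD']
    exact ⟨fun ⟨g, h1, h2⟩ => by rw [← h1, ← h2]; exact (hD.map_iff g p q).2 h,
      fun h' => hD.exists_map h h'⟩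
  · right
    intro u w
    rw [hD']
    exact ⟨fun ⟨g, h1, h2⟩ => by rw [← h1, ← h2]; exact (hD.map_iff g q p).2 h,
      fun h' => (hD.exists_map h h').imp fun _ hx => hx.symm⟩

end Orientation

section WeakMetacirculant

variable {V : Type*} {X : SimpleGraph V} {ρ σ : X ≃g X} {m n : ℕ}

theorem mem_orbit_iff {v w : V} : w ∈ orbit ρ v ↔ ∃ k : ℤ, (ρ ^ k) v = w := by
  constructor
  · rintro ⟨⟨_, k, rfl⟩, rfl⟩
    exact ⟨k, rfl⟩
  · rintro ⟨k, rfl⟩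
    exact ⟨⟨ρ ^ k, k, rfl⟩, rfl⟩

theorem orbit_eq_iff {v w : V} : orbit ρ v = orbit ρ w ↔ v ∈ orbit ρ w :=
  MulAction.orbit_eq_iff

theorem mem_orbit_self (v : V) : v ∈ orbit ρ v := MulAction.mem_orbit_self v

theorem mem_orbit_comm {v w : V} (h : v ∈ orbit ρ w) : w ∈ orbit ρ v :=
  MulAction.mem_orbit_symm.1 h

theorem mem_orbit_trans {u v w : V} (h : u ∈ orbit ρ v) (h' : v ∈ orbit ρ w) : u ∈ orbit ρ w := by
  rw [← orbit_eq_iff] at h h' ⊢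
  exact h.trans h'

theorem zpow_mem_orbit (k : ℤ) (v : V) : (ρ ^ k) v ∈ orbit ρ v := mem_orbit_iff.2 ⟨k, rfl⟩

theorem IsWeakMetacirculant.exists_map_eq (h : IsWeakMetacirculant X ρ σ m n) (v w : V) :
    ∃ g ∈ Subgroup.closure ({ρ, σ} : Set (X ≃g X)), g v = w := by
  obtain ⟨k, hk⟩ := h.cyclic v w
  obtain ⟨l, hl⟩ := mem_orbit_iff.1 hk
  refine ⟨(ρ ^ l)⁻¹ * σ ^ k, mul_mem (inv_mem (zpow_mem (Subgroup.subset_closure (by simp)) _))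
    (pow_mem (Subgroup.subset_closure (by simp)) _), ?_⟩
  rw [RelIso.mul_apply, ← hl, RelIso.inv_apply_self]

variable [Finite V]

theorem IsWeakMetacirculant.conj_mem (h : IsWeakMetacirculant X ρ σ m n) {g : X ≃g X}
    (hg : g ∈ Subgroup.closure ({ρ, σ} : Set (X ≃g X))) {x : X ≃g X}
    (hx : x ∈ Subgroup.zpowers ρ) : g * x * g⁻¹ ∈ Subgroup.zpowers ρ := by
  have : Finite (X ≃g X) := DFunLike.finite _
  have hle : Subgroup.closure ({ρ, σ} : Set (X ≃g X)) ≤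
      Subgroup.normalizer (Subgroup.zpowers ρ : Set (X ≃g X)) := by
    rw [Subgroup.closure_le]
    rintro y (rfl | rfl)
    · exact Subgroup.le_normalizer (Subgroup.mem_zpowers y)
    · refine Subgroup.mem_normalizer_fintype (fun z hz => ?_)
      obtain ⟨k, rfl⟩ := hz
      obtain ⟨r, hr⟩ := h.normalizes
      simp only
      rw [← conj_zpow, hr]
      exact zpow_mem (pow_mem (Subgroup.mem_zpowers _) _) k
  exact (Subgroup.mem_normalizer_iff.1 (hle hg) x).1 hx

theorem IsWeakMetacirculant.map_mem_orbit (h : IsWeakMetacirculant X ρ σ m n) {g : X ≃g X}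
    (hg : g ∈ Subgroup.closure ({ρ, σ} : Set (X ≃g X))) {v w : V} (hw : w ∈ orbit ρ v) :
    g w ∈ orbit ρ (g v) := by
  obtain ⟨k, rfl⟩ := mem_orbit_iff.1 hw
  obtain ⟨l, hl⟩ := h.conj_mem hg (zpow_mem (Subgroup.mem_zpowers ρ) k)
  refine mem_orbit_iff.2 ⟨l, ?_⟩
  simp only at hl
  rw [hl, RelIso.mul_apply, RelIso.mul_apply, RelIso.inv_apply_self]

/-- Every element of `⟨ρ, σ⟩` acts on the orbits of `ρ` like a power of `σ`. -/
theorem IsWeakMetacirculant.exists_shift (h : IsWeakMetacirculant X ρ σ m n) {g : X ≃g X}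
    (hg : g ∈ Subgroup.closure ({ρ, σ} : Set (X ≃g X))) :
    ∃ i : ℤ, ∀ v, g v ∈ orbit ρ ((σ ^ i) v) := by
  have hσ : ∀ i : ℤ, σ ^ i ∈ Subgroup.closure ({ρ, σ} : Set (X ≃g X)) := fun i =>
    zpow_mem (Subgroup.subset_closure (by simp)) i
  induction hg using Subgroup.closure_induction with
  | mem x hx =>
    rcases hx with rfl | rfl
    · exact ⟨0, fun v => by simpa using zpow_mem_orbit (ρ := x) 1 v⟩
    · exact ⟨1, fun v => by simpa using mem_orbit_self (x v)⟩
  | one => exact ⟨0, fun v => by simpa using mem_orbit_self v⟩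
  | mul x y _ _ hx hy =>
    obtain ⟨i, hi⟩ := hx
    obtain ⟨j, hj⟩ := hy
    refine ⟨i + j, fun v => ?_⟩
    rw [zpow_add, RelIso.mul_apply, RelIso.mul_apply]
    exact mem_orbit_trans (hi (y v)) (h.map_mem_orbit (hσ i) (hj v))
  | inv x _ hx =>
    obtain ⟨i, hi⟩ := hx
    refine ⟨-i, fun v => ?_⟩
    have h1 := hi (x⁻¹ v)
    rw [RelIso.apply_inv_self] at h1
    have h2 := h.map_mem_orbit (hσ (-i)) h1
    rw [← RelIso.mul_apply, ← zpow_add, neg_add_cancel, zpow_zero, RelIso.one_apply] at h2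
    exact mem_orbit_comm h2

/-- An element of `⟨ρ, σ⟩` that fixes an orbit of `ρ` setwise fixes all of them. -/
theorem IsWeakMetacirculant.mem_orbit_of_mem_orbit (h : IsWeakMetacirculant X ρ σ m n)
    {g : X ≃g X} (hg : g ∈ Subgroup.closure ({ρ, σ} : Set (X ≃g X))) {v : V}
    (hv : g v ∈ orbit ρ v) (w : V) : g w ∈ orbit ρ w := by
  obtain ⟨i, hi⟩ := h.exists_shift hg
  have hσ : ∀ i : ℤ, σ ^ i ∈ Subgroup.closure ({ρ, σ} : Set (X ≃g X)) := fun i =>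
    zpow_mem (Subgroup.subset_closure (by simp)) i
  obtain ⟨k, hk⟩ := h.cyclic v w
  have h1 : (σ ^ i) v ∈ orbit ρ v := mem_orbit_trans (mem_orbit_comm (hi v)) hv
  have h2 : (σ ^ (k : ℤ)) ((σ ^ i) v) ∈ orbit ρ ((σ ^ (k : ℤ)) v) := h.map_mem_orbit (hσ k) h1
  rw [← RelIso.mul_apply, ← zpow_add, add_comm, zpow_add, RelIso.mul_apply, zpow_natCast] at h2
  have h3 : (σ ^ i) w ∈ orbit ρ ((σ ^ i) ((σ ^ k) v)) :=
    h.map_mem_orbit (hσ i) (mem_orbit_comm hk)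
  exact mem_orbit_trans (hi w) (mem_orbit_trans h3 (mem_orbit_trans h2 hk))

theorem IsSemiregular.card_eq (h : IsSemiregular ρ m n) : Nat.card V = m * n := by
  classical
  have := Fintype.ofFinite V
  rw [Nat.card_eq_fintype_card, ← Finset.card_univ,
    Finset.card_eq_sum_card_image (orbit ρ) Finset.univ]
  have h1 : ∀ s ∈ Finset.univ.image (orbit ρ), (Finset.univ.filter (orbit ρ · = s)).card = n := by
    intro s hs
    obtain ⟨v, -, rfl⟩ := Finset.mem_image.1 hs
    rw [← h.card_orbit v, ← Set.ncard_coe_finset]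
    congr 1
    ext w
    simp [orbit_eq_iff]
  rw [Finset.sum_congr rfl h1, Finset.sum_const, smul_eq_mul, ← h.card_orbits,
    ← Set.ncard_coe_finset]
  simp

end WeakMetacirculant

section ClassII

variable {V : Type*} {X : SimpleGraph V} {D : V → V → Prop} {ρ σ : X ≃g X} {m n : ℕ}

theorem IsClassII.exists_inner (hII : IsClassII X ρ σ m n) (hX : IsHalfArcTransitive X)
    (hD : IsAutOrientation X D) (v : V) :
    ∃ k : ℤ, D v ((ρ ^ k) v) ∧ D ((ρ ^ (-k)) v) v ∧
      ∀ u, X.Adj v u → u ∈ orbit ρ v → u = (ρ ^ k) v ∨ u = (ρ ^ (-k)) v := by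
  have hflip : ∀ k : ℤ, D v ((ρ ^ k) v) ↔ D ((ρ ^ (-k)) v) v := by
    intro k
    rw [← hD.map_iff (ρ ^ (-k)), ← RelIso.mul_apply, ← zpow_add, neg_add_cancel, zpow_zero,
      RelIso.one_apply]
  obtain ⟨x, y, hxy, hS⟩ := Set.ncard_eq_two.1 (hII.inner v)
  have hmem : ∀ u, (X.Adj v u ∧ u ∈ orbit ρ v) ↔ u = x ∨ u = y := by
    intro u
    have := Set.ext_iff.1 hS u
    simpa using this
  obtain ⟨hadj, hx⟩ := (hmem x).2 (Or.inl rfl)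
  obtain ⟨k, hk⟩ : ∃ k : ℤ, D v ((ρ ^ k) v) := by
    obtain ⟨k, rfl⟩ := mem_orbit_iff.1 hx
    rcases (hD.adj_iff hX _ _).1 hadj with h | h
    · exact ⟨k, h⟩
    · exact ⟨-k, by rwa [hflip, neg_neg]⟩
  have hk' := (hflip k).1 hk
  refine ⟨k, hk, hk', fun u hu hu' => ?_⟩
  have h1 := (hmem _).1 ⟨(hD.adj_iff hX _ _).2 (Or.inl hk), zpow_mem_orbit k v⟩
  have h2 := (hmem _).1 ⟨(hD.adj_iff hX _ _).2 (Or.inr hk'), zpow_mem_orbit (-k) v⟩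
  have h3 : (ρ ^ k) v ≠ (ρ ^ (-k)) v := by
    intro h
    rw [← h] at hk'
    exact hD.asymm hX hk hk'
  have h4 := (hmem u).1 ⟨hu, hu'⟩
  grind

variable [Finite V]

/-- The group `⟨ρ, σ⟩` acts semiregularly: an element fixing `v` preserves the orientation, which
distinguishes the two inner neighbours of `v`, and all orbits of `ρ`, which distinguish the two
outer neighbours; it therefore fixes all neighbours of `v`. -/
theorem IsClassII.eq_one_of_fixes (hII : IsClassII X ρ σ m n) (hX : IsHalfArcTransitive X)
    (hD : IsAutOrientation X D) (hconn : X.Connected) {g : X ≃g X}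
    (hg : g ∈ Subgroup.closure ({ρ, σ} : Set (X ≃g X))) {v : V} (hv : g v = v) : g = 1 := by
  have hW := hII.weakMetacirculant
  have horb : ∀ w, g w ∈ orbit ρ w :=
    hW.mem_orbit_of_mem_orbit hg (v := v) (by rw [hv]; exact mem_orbit_self v)
  have hstep : ∀ u w, X.Adj u w → g u = u → g w = w := by
    intro u w huw hu
    have hadj : X.Adj u (g w) := by
      have := g.map_adj_iff.2 huw
      rwa [hu] at this
    by_cases hw : w ∈ orbit ρ u
    · obtain ⟨k, h1, h2, h3⟩ := hII.exists_inner hX hD u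
      have hgw : g w ∈ orbit ρ u := mem_orbit_trans (horb w) hw
      have hne : ¬ (D u w ∧ D (g w) u) := by
        rintro ⟨h4, h5⟩
        have := (hD.map_iff g _ _).2 h4
        rw [hu] at this
        exact hD.asymm hX this h5
      have hne' : ¬ (D w u ∧ D u (g w)) := by
        rintro ⟨h4, h5⟩
        have := (hD.map_iff g _ _).2 h4
        rw [hu] at this
        exact hD.asymm hX this h5
      rcases h3 w huw hw with h4 | h4 <;> rcases h3 _ hadj hgw with h5 | h5
      · exact h5.trans h4.symm
      · exact absurd ⟨h4 ▸ h1, h5 ▸ h2⟩ hne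
      · exact absurd ⟨h4 ▸ h2, h5 ▸ h1⟩ hne'
      · exact h5.trans h4.symm
    · obtain ⟨w₁, w₂, hS, hne⟩ := hII.outer u
      have hmem : ∀ x, (X.Adj u x ∧ x ∉ orbit ρ u) ↔ x = w₁ ∨ x = w₂ := by
        intro x
        have := Set.ext_iff.1 hS x
        simpa using this
      have hgw : g w ∉ orbit ρ u := fun h =>
        hw (mem_orbit_trans (mem_orbit_comm (horb w)) h)
      have h1 := orbit_eq_iff.2 (horb w)
      rcases (hmem w).1 ⟨huw, hw⟩ with h4 | h4 <;> rcases (hmem _).1 ⟨hadj, hgw⟩ with h5 | h5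
      · exact h5.trans h4.symm
      · rw [h5, h4] at h1; exact absurd h1.symm hne
      · rw [h5, h4] at h1; exact absurd h1 hne
      · exact h5.trans h4.symm
  ext w
  rw [RelIso.one_apply]
  obtain ⟨p⟩ := hconn.preconnected v w
  induction p with
  | nil => exact hv
  | cons hadj p ih => exact ih (hstep _ _ hadj hv)

end ClassII

/-! ### The regular group -/

section CayleyStructure

variable {V : Type*} [Finite V] {X : SimpleGraph V} {D : V → V → Prop} {ρ σ : X ≃g X} {m n : ℕ}

theorem IsClassII.three_le (hII : IsClassII X ρ σ m n) (v : V) : 3 ≤ m := by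
  obtain ⟨w₁, w₂, hS, hne⟩ := hII.outer v
  have hmem : ∀ x, (X.Adj v x ∧ x ∉ orbit ρ v) ↔ x = w₁ ∨ x = w₂ := by
    intro x
    have := Set.ext_iff.1 hS x
    simpa using this
  have h1 : orbit ρ v ≠ orbit ρ w₁ := fun h =>
    ((hmem w₁).2 (Or.inl rfl)).2 (orbit_eq_iff.1 h.symm)
  have h2 : orbit ρ v ≠ orbit ρ w₂ := fun h =>
    ((hmem w₂).2 (Or.inr rfl)).2 (orbit_eq_iff.1 h.symm)
  have h3 : ({orbit ρ v, orbit ρ w₁, orbit ρ w₂} : Set (Set V)).ncard = 3 :=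
    Set.ncard_eq_three.2 ⟨_, _, _, h1, h2, hne, rfl⟩
  rw [← hII.weakMetacirculant.semiregular.card_orbits, ← h3]
  refine Set.ncard_le_ncard ?_ (Set.finite_range _)
  rintro s (rfl | rfl | rfl) <;> exact ⟨_, rfl⟩

/-- The oriented graph `X` is a Cayley digraph of the regular group `⟨ρ, σ⟩`: `a` is the power of
`ρ` that maps `v₀` to its inner out-neighbour, and `b` maps `v₀` to its outer out-neighbour. -/
theorem IsClassII.exists_generators (hII : IsClassII X ρ σ m n) (hX : IsHalfArcTransitive X)
    (hD : IsAutOrientation X D) (hconn : X.Connected) {Γ : Subgroup (X ≃g X)}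
    (hΓ : Γ = Subgroup.closure {ρ, σ}) (v₀ : V) :
    ∃ (a b : Γ) (e : Γ ≃ V), (∀ g : Γ, e g = (g : X ≃g X) v₀) ∧ IsMetacyclicPair a b ∧ a ≠ b ∧
      (∀ g h, D (e g) (e h) ↔ cayleyArc a b g h) ∧ 3 ≤ (Subgroup.zpowers a).index ∧
      (orderOf a = orderOf b → (Subgroup.zpowers a).index = m ∧ orderOf a = n) := by
  have : Finite (X ≃g X) := DFunLike.finite _
  have hW := hII.weakMetacirculant
  have hfix : ∀ g ∈ Γ, ∀ v, g v = v → g = 1 := fun g hg v hv =>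
    hII.eq_one_of_fixes hX hD hconn (hΓ ▸ hg) hv
  have htrans : ∀ v w, ∃ g ∈ Γ, g v = w := by
    subst hΓ; exact hW.exists_map_eq
  have hconj : ∀ g ∈ Γ, ∀ x ∈ Subgroup.zpowers ρ, g * x * g⁻¹ ∈ Subgroup.zpowers ρ := by
    subst hΓ; exact fun g hg x hx => hW.conj_mem hg hx
  have hρΓ : ρ ∈ Γ := by subst hΓ; exact Subgroup.subset_closure (by simp)
  clear hΓ
  let f : Γ → V := fun g => (g : X ≃g X) v₀
  have hinj : Function.Injective f := by
    intro g h hgh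
    have h1 : ((h⁻¹ * g : Γ) : X ≃g X) = 1 := by
      apply hfix _ (h⁻¹ * g).2 v₀
      have h2 : (g : X ≃g X) v₀ = (h : X ≃g X) v₀ := hgh
      rw [Subgroup.coe_mul, RelIso.mul_apply, h2, Subgroup.coe_inv, RelIso.inv_apply_self]
    exact (inv_mul_eq_one.1 (Subtype.ext h1)).symm
  have hsurj : Function.Surjective f := fun w => by
    obtain ⟨g, hg, hgw⟩ := htrans v₀ w
    exact ⟨⟨g, hg⟩, hgw⟩
  let e : Γ ≃ V := Equiv.ofBijective f ⟨hinj, hsurj⟩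
  have he : ∀ g : Γ, e g = (g : X ≃g X) v₀ := fun _ => rfl
  have hemul : ∀ g h : Γ, e (g * h) = (g : X ≃g X) (e h) := fun _ _ => rfl
  have hDmul : ∀ g h k : Γ, D (e (g * h)) (e (g * k)) ↔ D (e h) (e k) := fun g h k => by
    rw [hemul, hemul, hD.map_iff]
  have he1 : e 1 = v₀ := rfl
  -- The inner generator.
  obtain ⟨k, hk1, hk2, hk3⟩ := hII.exists_inner hX hD v₀
  let ρ' : Γ := ⟨ρ, hρΓ⟩
  let a : Γ := ρ' ^ k
  have ha : e a = (ρ ^ k) v₀ := by simp [he, a, ρ']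
  have ha' : e a⁻¹ = (ρ ^ (-k)) v₀ := by simp [he, a, ρ', zpow_neg]
  have hDa : D (e 1) (e a) := by rw [ha]; exact hk1
  -- The outer generator.
  obtain ⟨w₁, w₂, hS, hne⟩ := hII.outer v₀
  have hmem : ∀ x, (X.Adj v₀ x ∧ x ∉ orbit ρ v₀) ↔ x = w₁ ∨ x = w₂ := by
    intro x
    have := Set.ext_iff.1 hS x
    simpa using this
  have hρconj : ∀ g : Γ, ∀ x ∈ Subgroup.zpowers ρ', g * x * g⁻¹ ∈ Subgroup.zpowers ρ' := by
    rintro g x ⟨i, rfl⟩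
    obtain ⟨j, hj⟩ := hconj g g.2 (ρ ^ i) ⟨i, rfl⟩
    exact ⟨j, Subtype.ext (by simpa [ρ'] using hj)⟩
  have horb : ∀ g : Γ, e g ∈ orbit ρ v₀ ↔ g ∈ Subgroup.zpowers ρ' := by
    intro g
    rw [mem_orbit_iff]
    constructor
    · rintro ⟨j, hj⟩
      exact ⟨j, e.injective (by rw [← hj]; simp [he, ρ'])⟩
    · rintro ⟨j, rfl⟩
      exact ⟨j, by simp [he, ρ']⟩
  obtain ⟨b, hDb, hb⟩ : ∃ b : Γ, D (e 1) (e b) ∧ b ∉ Subgroup.zpowers ρ' := by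
    obtain ⟨hadj, hw⟩ := (hmem w₁).2 (Or.inl rfl)
    obtain ⟨τ, hτ⟩ := e.surjective w₁
    rw [← hτ, horb] at hw
    rw [← hτ] at hadj
    rcases (hD.adj_iff hX _ _).1 hadj with h | h
    · exact ⟨τ, h, hw⟩
    · refine ⟨τ⁻¹, ?_, fun h' => hw (inv_mem_iff.1 h')⟩
      rw [← hDmul τ]
      simpa [he1] using h
  have hab : a ≠ b := by
    rintro rfl
    exact hb (zpow_mem (Subgroup.mem_zpowers ρ') k)
  have hinv : ∀ c : Γ, D (e 1) (e c) → D (e c⁻¹) (e 1) := by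
    intro c hc
    rw [← hDmul c]
    simpa using hc
  have hDb' := hinv b hDb
  have hnbr : ∀ c : Γ, X.Adj (e 1) (e c) → c = a ∨ c = a⁻¹ ∨ c = b ∨ c = b⁻¹ := by
    intro c hc
    by_cases hin : e c ∈ orbit ρ v₀
    · rcases hk3 _ hc hin with h | h
      · exact Or.inl (e.injective (h.trans ha.symm))
      · exact Or.inr (Or.inl (e.injective (h.trans ha'.symm)))
    · have h1 := (hmem _).1 ⟨hc, hin⟩
      have h2 := (hmem (e b)).1 ⟨(hD.adj_iff hX _ _).2 (Or.inl hDb), by rwa [horb]⟩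
      have h3 := (hmem (e b⁻¹)).1 ⟨(hD.adj_iff hX _ _).2 (Or.inr hDb'), by
        rwa [horb, inv_mem_iff]⟩
      have h4 : e b ≠ e b⁻¹ := by
        intro h
        rw [← h] at hDb'
        exact hD.asymm hX hDb hDb'
      have h5 : e c = e b ∨ e c = e b⁻¹ := by grind
      rcases h5 with h5 | h5
      · exact Or.inr (Or.inr (Or.inl (e.injective h5)))
      · exact Or.inr (Or.inr (Or.inr (e.injective h5)))
  have hD1 : ∀ c : Γ, D (e 1) (e c) ↔ c = a ∨ c = b := by
    intro c
    constructor
    · intro hc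
      rcases hnbr c ((hD.adj_iff hX _ _).2 (Or.inl hc)) with rfl | rfl | rfl | rfl
      · exact Or.inl rfl
      · exact absurd (hinv a hDa) (hD.asymm hX hc)
      · exact Or.inr rfl
      · exact absurd hDb' (hD.asymm hX hc)
    · rintro (rfl | rfl)
      · exact hDa
      · exact hDb
  have harc : ∀ g h, D (e g) (e h) ↔ cayleyArc a b g h := by
    intro g h
    have h1 := hDmul g 1 (g⁻¹ * h)
    rw [mul_one, mul_inv_cancel_left] at h1
    rw [h1, hD1, cayleyArc, inv_mul_eq_iff_eq_mul, inv_mul_eq_iff_eq_mul]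
  have hgen : Subgroup.closure {a, b} = ⊤ := by
    have hadj : ∀ v w : V, X.Adj v w → e.symm v ∈ Subgroup.closure {a, b} →
        e.symm w ∈ Subgroup.closure {a, b} := by
      intro v w hvw hv
      have h1 : (e.symm v)⁻¹ * e.symm w ∈ Subgroup.closure {a, b} := by
        have h2 : X.Adj (e 1) (e ((e.symm v)⁻¹ * e.symm w)) := by
          rw [hD.adj_iff hX, ← hDmul (e.symm v), ← hDmul (e.symm v) _ 1, ← hD.adj_iff hX]
          simpa using hvw
        have haC : a ∈ Subgroup.closure {a, b} := Subgroup.subset_closure (by simp)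
        have hbC : b ∈ Subgroup.closure {a, b} := Subgroup.subset_closure (by simp)
        rcases hnbr _ h2 with h | h | h | h <;> rw [h]
        · exact haC
        · exact inv_mem haC
        · exact hbC
        · exact inv_mem hbC
      have := mul_mem hv h1
      rwa [mul_inv_cancel_left] at this
    have hreach : ∀ v w : V, X.Walk v w → e.symm v ∈ Subgroup.closure {a, b} →
        e.symm w ∈ Subgroup.closure {a, b} := by
      intro v w p
      induction p with
      | nil => exact id
      | cons h p ih => exact fun hv => ih (hadj _ _ h hv)
    rw [eq_top_iff]
    intro g _
    obtain ⟨p⟩ := hconn.preconnected (e 1) (e g)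
    simpa using hreach _ _ p (by simp)
  have hnormal : (Subgroup.zpowers a).Normal := by
    constructor
    rintro x ⟨i, rfl⟩ g
    obtain ⟨j, hj⟩ := hρconj g ρ' (Subgroup.mem_zpowers ρ')
    refine ⟨j * i, ?_⟩
    simp only [a] at hj ⊢
    rw [← conj_zpow, ← conj_zpow, ← hj, ← zpow_mul, ← zpow_mul, ← zpow_mul]
    congr 1; ring
  have hpair : IsMetacyclicPair a b := ⟨hgen, hnormal⟩
  have hcard : Nat.card Γ = m * n := by
    rw [Nat.card_congr e, hW.semiregular.card_eq]
  have hρn : Nat.card (Subgroup.zpowers ρ') = n := by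
    rw [← hW.semiregular.card_orbit v₀]
    have h1 : orbit ρ v₀ = e '' (Subgroup.zpowers ρ' : Set Γ) := by
      ext w
      rw [Set.mem_image]
      constructor
      · intro hw
        exact ⟨e.symm w, (horb _).1 (by simpa using hw), by simp⟩
      · rintro ⟨g, hg, rfl⟩
        exact (horb g).2 hg
    rw [h1, Set.ncard_image_of_injective _ e.injective]
    rfl
  have hle : Subgroup.zpowers a ≤ Subgroup.zpowers ρ' := by
    rw [Subgroup.zpowers_le]
    exact zpow_mem (Subgroup.mem_zpowers ρ') k
  have hn0 : 0 < n := by have := hW.semiregular.two_le; omega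
  have hρindex : (Subgroup.zpowers ρ').index = m := by
    have := Subgroup.card_mul_index (Subgroup.zpowers ρ')
    rw [hρn, hcard, mul_comm] at this
    exact Nat.eq_of_mul_eq_mul_right hn0 this
  have hmle : m ≤ (Subgroup.zpowers a).index := by
    rw [← hρindex]
    exact Nat.le_of_dvd (Nat.pos_of_ne_zero Subgroup.index_ne_zero_of_finite)
      (Subgroup.index_dvd_of_le hle)
  refine ⟨a, b, e, he, hpair, hab, harc, (hII.three_le v₀).trans hmle, fun horder => ?_⟩
  have hnormρ : (Subgroup.zpowers ρ').Normal := ⟨fun x hx g => hρconj g x hx⟩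
  have hbm : b ^ m ∈ Subgroup.zpowers a := by
    apply mem_zpowers_of_pow_orderOf_eq_one (c := ρ') (zpow_mem (Subgroup.mem_zpowers ρ') k)
    · rw [← hρindex]
      exact Subgroup.pow_index_mem _ b
    · rw [horder, ← pow_mul, mul_comm, pow_mul, pow_orderOf_eq_one, one_pow]
  have hm : (Subgroup.zpowers a).index = m := by
    refine le_antisymm (Nat.le_of_dvd ?_ ((hpair.pow_mem_iff m).1 hbm)) hmle
    have := hW.semiregular.one_le
    omega
  refine ⟨hm, ?_⟩
  have := Subgroup.card_mul_index (Subgroup.zpowers a)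
  rw [hm, Nat.card_zpowers, hcard, mul_comm m] at this
  exact Nat.eq_of_mul_eq_mul_right (by have := hW.semiregular.one_le; omega) this

end CayleyStructure

section AntiAutomorphism

variable {V : Type*} {X : SimpleGraph V} {D : V → V → Prop}

/-- Half-arc-transitivity excludes anti-automorphisms of the Cayley digraph. -/
theorem not_exists_reversing {G : Type*} [Group G] [Finite G] {a b : G}
    (hX : IsHalfArcTransitive X) (hD : IsAutOrientation X D) {e : G ≃ V}
    (harc : ∀ g h, D (e g) (e h) ↔ cayleyArc a b g h) :
    ¬ ∃ ψ : Equiv.Perm G, ∀ g h, cayleyArc a b g h → cayleyArc a b (ψ h) (ψ g) := by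
  rintro ⟨ψ, hψ⟩
  let y : V ≃ V := (e.symm.trans ψ).trans e
  have hy : ∀ u w, D (y u) (y w) ↔ D w u := by
    intro u w
    have h1 := cayleyArc_reverse_iff hψ (e.symm w) (e.symm u)
    rw [← harc, ← harc, e.apply_symm_apply, e.apply_symm_apply] at h1
    exact h1
  let x : X ≃g X := ⟨y, by
    intro u w
    rw [hD.adj_iff hX, hD.adj_iff hX]
    rw [hy, hy]
    exact or_comm⟩
  have h1 : D (e 1) (e a) := (harc 1 a).2 (Or.inl (by simp))
  have h2 : D (x (e 1)) (x (e a)) := (hD.map_iff x _ _).2 h1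
  exact hD.asymm hX h1 ((hy _ _).1 h2)

end AntiAutomorphism

/-! ### Assembling the conclusions -/

section Conclusion

variable {V : Type*} {X : SimpleGraph V} {D : V → V → Prop}

theorem exists_isAutOrientation {u v : V} (h : X.Adj u v) : ∃ D, IsAutOrientation X D :=
  ⟨fun u' v' => ∃ g : X ≃g X, g u = u' ∧ g v = v', u, v, h, fun _ _ => Iff.rfl⟩

theorem isCayleyGraphOf_of_equiv {Γ : Subgroup (X ≃g X)} {v₀ : V} (e : Γ ≃ V)
    (he : ∀ g : Γ, e g = (g : X ≃g X) v₀) : IsCayleyGraphOf X Γ := by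
  have hadj : ∀ g h : Γ, X.Adj (e g) (e h) ↔ X.Adj v₀ (e (g⁻¹ * h)) := by
    intro g h
    have h1 : e h = (g : X ≃g X) (e (g⁻¹ * h)) := by
      rw [he, he, ← RelIso.mul_apply, ← Subgroup.coe_mul, mul_inv_cancel_left]
    rw [h1, he g, SimpleGraph.Iso.map_adj_iff]
  have he1 : e 1 = v₀ := he 1
  refine ⟨{s | X.Adj v₀ (e s)}, fun h => ?_, fun s hs => ?_, ⟨⟨e.symm, fun {u w} => ?_⟩⟩⟩
  · rw [Set.mem_ofPred_eq, he1] at h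
    exact X.irrefl h
  · have := hadj s 1
    rw [mul_one, he1] at this
    exact this.1 (SimpleGraph.Adj.symm hs)
  · rw [SimpleGraph.mulCayley_adj']
    obtain ⟨g, rfl⟩ := e.surjective u
    obtain ⟨h, rfl⟩ := e.surjective w
    rw [e.symm_apply_apply, e.symm_apply_apply]
    constructor
    · rintro ⟨-, s, hs, rfl | rfl⟩
      · rw [hadj, inv_mul_cancel_left]; exact hs
      · rw [X.adj_comm, hadj, inv_mul_cancel_left]; exact hs
    · intro hgh
      refine ⟨fun h' => X.irrefl (h' ▸ hgh), g⁻¹ * h, (hadj g h).1 hgh, Or.inl (by simp)⟩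

variable {G : Type*} [Group G] {a b : G}

/-- An automorphism of the graph, read as a permutation of the regular group. -/
theorem conj_mem_arcPerms (hD : IsAutOrientation X D) {e : G ≃ V}
    (harc : ∀ g h, D (e g) (e h) ↔ cayleyArc a b g h) (x : X ≃g X) :
    (e.trans x.toEquiv).trans e.symm ∈ arcPerms a b := by
  intro g h
  rw [← harc, ← harc]
  simpa using hD.map_iff x (e g) (e h)

/-- The vertex stabilizer has order two as soon as arcs have trivial stabilizers, because it acts
transitively on the two out-neighbours of the vertex. -/
theorem nonempty_stabilizer_mulEquiv (hD : IsAutOrientation X D) (hne : a ≠ b) {e : G ≃ V}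
    (harc : ∀ g h, D (e g) (e h) ↔ cayleyArc a b g h)
    (hrigid : ∀ x ∈ arcPerms a b, x 1 = 1 → x a = a → x = 1) :
    Nonempty (MulAction.stabilizer (X ≃g X) (e 1) ≃* Multiplicative (ZMod 2)) := by
  have hrig : ∀ x : X ≃g X, x (e 1) = e 1 → x (e a) = e a → x = 1 := by
    intro x h1 ha
    have h2 := hrigid _ (conj_mem_arcPerms hD harc x) (by simp [h1]) (by simp [ha])
    ext v
    have h3 := congrArg e (Equiv.congr_fun h2 (e.symm v))
    simpa using h3
  have hDa : D (e 1) (e a) := (harc 1 a).2 (Or.inl (by simp))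
  have hDb : D (e 1) (e b) := (harc 1 b).2 (Or.inr (by simp))
  obtain ⟨x, hx1, hxa⟩ := hD.exists_map hDa hDb
  have hx : x ≠ 1 := by
    rintro rfl
    exact hne (e.injective hxa)
  have hcases : ∀ y : X ≃g X, y (e 1) = e 1 → y = 1 ∨ y = x := by
    intro y hy
    have h1 : D (e 1) (y (e a)) := by
      have := (hD.map_iff y (e 1) (e a)).2 hDa
      rwa [hy] at this
    rw [← e.apply_symm_apply (y (e a)), harc, cayleyArc, one_mul, one_mul] at h1
    rcases h1 with h1 | h1
    · exact Or.inl (hrig y hy (e.symm_apply_eq.1 h1))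
    · right
      have h2 : x⁻¹ * y = 1 := by
        apply hrig
        · rw [RelIso.mul_apply, hy, ← hx1, RelIso.inv_apply_self, hx1]
        · rw [RelIso.mul_apply, e.symm_apply_eq.1 h1, ← hxa, RelIso.inv_apply_self]
      exact (inv_mul_eq_one.1 h2).symm
  have hcard : Nat.card (MulAction.stabilizer (X ≃g X) (e 1)) = 2 := by
    rw [Nat.card_eq_two_iff]
    refine ⟨1, ⟨x, hx1⟩, fun h => hx (congrArg Subtype.val h).symm, ?_⟩
    ext y
    rcases hcases y y.2 with h | h
    · simp [Subtype.ext_iff, h]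
    · simp [Subtype.ext_iff, h]
  have : Fact (Nat.Prime 2) := ⟨Nat.prime_two⟩
  exact ⟨mulEquivOfPrimeCardEq (p := 2) hcard (by simp)⟩

theorem nonempty_iso_yGraph (hX : IsHalfArcTransitive X) (hD : IsAutOrientation X D) {e : G ≃ V}
    (harc : ∀ g h, D (e g) (e h) ↔ cayleyArc a b g h) {m n : ℕ} {r : (ZMod n)ˣ} {t : ZMod n}
    {φ : ZMod m × ZMod n ≃ G} (hφ : ∀ x y, cayleyArc a b (φ x) (φ y) ↔ yArc m n r t x y) :
    Nonempty (X ≃g yGraph m n r t) := by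
  have hadj : ∀ x y, X.Adj (e (φ x)) (e (φ y)) ↔ (yGraph m n r t).Adj x y := by
    intro x y
    rw [yGraph, SimpleGraph.fromRel_adj, ← hφ, ← hφ, ← harc, ← harc, ← hD.adj_iff hX]
    exact ⟨fun h => ⟨by rintro rfl; exact X.irrefl h, h⟩, And.right⟩
  let f : yGraph m n r t ≃g X := ⟨φ.trans e, fun {x y} => hadj x y⟩
  exact ⟨f.symm⟩

/-- If the commutator of the generators lies in `⟨a * b⁻¹⟩`, this subgroup is normal, its cosets are
the common vertices of adjacent alternating cycles, and the graph is tightly attached. -/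
theorem isTightlyAttached_of_commutator_mem [Finite G] (hX : IsHalfArcTransitive X)
    (hD : IsAutOrientation X D) (hne : a ≠ b) {e : G ≃ V}
    (harc : ∀ g h, D (e g) (e h) ↔ cayleyArc a b g h) (hab : IsSwapPair a b)
    (h3 : 3 ≤ (Subgroup.zpowers a).index)
    (hz : b * a * b⁻¹ * a⁻¹ ∈ Subgroup.zpowers (a * b⁻¹)) : IsTightlyAttached X := by
  obtain ⟨hP, ha, ha2, hinv⟩ := hab.normal_of_commutator_mem h3 hz
  intro D' hD'
  rcases IsAutOrientation.eq_or_eq_reverse hX hD hD' with h | h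
  · exact ⟨_, hasRadius_and_hasAttachmentNumber hne (fun g k => (h _ _).trans (harc g k))
      (hD'.adj_iff hX) ha ha2⟩
  · have hP' : (Subgroup.zpowers (a⁻¹ * b⁻¹⁻¹)).Normal := by rwa [hinv]
    have harc' : ∀ g k, D' (e g) (e k) ↔ cayleyArc a⁻¹ b⁻¹ g k := by
      intro g k
      rw [h, harc, cayleyArc, cayleyArc, eq_mul_inv_iff_mul_eq, eq_mul_inv_iff_mul_eq,
        eq_comm (a := g), eq_comm (a := g)]
    refine ⟨_, hasRadius_and_hasAttachmentNumber (inv_injective.ne hne) harc'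
      (hD'.adj_iff hX) ?_ ?_⟩
    · rwa [hinv, inv_mem_iff]
    · rwa [hinv, ← mul_inv_rev, inv_mem_iff]

end Conclusion

end Metacirculant

theorem theorem5p1 {V : Type*} [Fintype V] (X : SimpleGraph V) [DecidableRel X.Adj]
    (m n : ℕ) (ρ σ : X ≃g X)
    (hconn : X.Connected) (hquartic : X.IsRegularOfDegree 4)
    (hhat : Metacirculant.IsHalfArcTransitive X)
    (hII : Metacirculant.IsClassII X ρ σ m n) :
    Metacirculant.IsCayleyGraphOf X (Subgroup.closure ({ρ, σ} : Set (X ≃g X))) ∧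
    (∀ v : V, Nonempty (MulAction.stabilizer (X ≃g X) v ≃* Multiplicative (ZMod 2))) ∧
    (m ∣ n ∧ 2 < n / m) ∧
    (3 ≤ m ∧ 3 ≤ n ∧ ∃ (r : (ZMod n)ˣ) (t : ZMod n),
      Nonempty (X ≃g Metacirculant.yGraph m n r t) ∧
      r ^ m = 1 ∧
      (m : ZMod n) * ((r : ZMod n) - 1) = 0 ∧ t * ((r : ZMod n) - 1) = 0 ∧
      ((r : ZMod n) - 1) ^ 2 = 0 ∧
      AddSubgroup.zmultiples (m : ZMod n) = AddSubgroup.zmultiples t ∧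
      (∃! c : ℕ, c < n / m ∧ t = (c : ZMod n) * (m : ZMod n) ∧ (m : ZMod n) = (c : ZMod n) * t) ∧
      (∃! a : ℕ, a < n / m ∧ (a : ZMod n) * t = (r : ZMod n) - 1 ∧
        -((a : ZMod n) * (m : ZMod n)) = (r : ZMod n) - 1)) ∧
    (¬ Metacirculant.IsTightlyAttached X →
      Even m ∧ Even (n / m) ∧ ∃ n₁ : ℕ, n = 8 * n₁ ∧ 2 < n₁ ∧ (Even n₁ ∨ ¬ Squarefree n₁)) := by
  open Metacirculant in
  have hfin : Finite (X ≃g X) := DFunLike.finite _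
  obtain ⟨v⟩ := hconn.nonempty
  obtain ⟨w, hw⟩ : ∃ w, X.Adj v w := by
    obtain ⟨w, hw⟩ := Set.nonempty_of_ncard_ne_zero (s := {w | X.Adj v w ∧ w ∈ orbit ρ v})
      (by rw [hII.inner v]; decide)
    exact ⟨w, hw.1⟩
  obtain ⟨D, hD⟩ := exists_isAutOrientation hw
  -- The data attached to a base vertex `v₀`: regular generators, rigidity, and the swap.
  have key : ∀ v₀ : V, ∃ (a b : Subgroup.closure ({ρ, σ} : Set (X ≃g X)))
      (e : Subgroup.closure ({ρ, σ} : Set (X ≃g X)) ≃ V),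
      (∀ g, e g = (g : X ≃g X) v₀) ∧ a ≠ b ∧ (∀ g h, D (e g) (e h) ↔ cayleyArc a b g h) ∧
      (Subgroup.zpowers a).index = m ∧ orderOf a = n ∧
      (∀ x ∈ arcPerms a b, x 1 = 1 → x a = a → x = 1) ∧ IsSwapPair a b := by
    intro v₀
    obtain ⟨a, b, e, he, hpair, hne, harc, h3, hidx⟩ :=
      hII.exists_generators hhat hD hconn rfl v₀
    have hx : ∃ x ∈ arcPerms a b, x 1 = 1 ∧ x a = b := by
      obtain ⟨x, hx1, hxa⟩ := hD.exists_map ((harc 1 a).2 (Or.inl (by simp)))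
        ((harc 1 b).2 (Or.inr (by simp)))
      exact ⟨_, conj_mem_arcPerms hD harc x, by simp [hx1], by simp [hxa]⟩
    obtain ⟨hrigid, hswap⟩ :=
      arc_rigid_and_exists_swap hpair hne h3 hx (not_exists_reversing hhat hD harc)
    obtain ⟨θ, hθ, -⟩ := hswap.exists_swap
    obtain ⟨hm, hn⟩ := hidx (by rw [← hθ, MulEquiv.orderOf_eq])
    exact ⟨a, b, e, he, hne, harc, hm, hn, hrigid, hswap⟩
  obtain ⟨a, b, e, he, hne, harc, hm, hn, -, hswap⟩ := key v
  have h3 : 3 ≤ m := hII.three_le v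
  have hrev := not_exists_reversing hhat hD harc
  obtain ⟨hmn, hn3, r, t, ⟨φ, hφ⟩, -, hpar⟩ :=
    hswap.exists_yArc_parameters hm hn h3 (fun h => hrev (hswap.exists_reversing_perm h))
  refine ⟨isCayleyGraphOf_of_equiv e he, fun v₀ => ?_, hmn,
    ⟨h3, hn3, r, t, nonempty_iso_yGraph hhat hD harc hφ, hpar⟩, fun htight => ?_⟩
  · obtain ⟨a', b', e', he', hne', harc', -, -, hrigid', -⟩ := key v₀
    have h := nonempty_stabilizer_mulEquiv hD hne' harc' hrigid'
    rwa [show e' 1 = v₀ from he' 1] at h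
  · exact hswap.arithmetic_of_commutator_not_mem hm hn h3 hrev fun hz =>
      htight (isTightlyAttached_of_commutator_mem hhat hD hne harc hswap (hm ▸ h3) hz)
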